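/- Let $S$ be a finite (non-empty) semigroup and let $\mathbb{Q}S$ be its rational semigroup algebra. A finite-dimensional $\mathbb{Q}$-algebra $A$ with identity has the hyperbolic property if for every $\mathbb{Z}$-order $\Gamma$ of $A$ (a subring of $A$ containing the identity of $A$, finitely generated as a $\mathbb{Z}$-module and spanning $A$ over $\mathbb{Q}$) the unit group of $\Gamma$ has no subgroup isomorphic to $\mathbb{Z}^2$; an algebra without identity is not considered to have this property. A Higman group is a finite group that is either abelian of exponent dividing $4$ or $6$, or a Hamiltonian $2$-group (a nonabelian $2$-group all of whose subgroups are normal). A principal series of $S$ is a chain $S=S_1\supset S_2\supset\cdots\supset S_n\supset S_{n+1}=\emptyset$ of ideals of $S$ such that $S_{i+1}$ is a maximal ideal of $S_i$ for $1\le i\le n$ (the empty set counts as an ideal); its factors are the Rees factors $S_i/S_{i+1}=(S_i\setminus S_{i+1})\cup\{\theta\}$, where $\theta$ is a zero element and a product of two elements of $S_i\setminus S_{i+1}$ is their product in $S$ if that lies outside $S_{i+1}$, and $\theta$ otherwise. For a group $G$, let $G^\theta$ denote $G$ with a zero element $\theta$ adjoined. Then the following are equivalent: (a) $\mathbb{Q}S$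 has no nonzero nilpotent elements and has the hyperbolic property; (b) $S$ has a principal series $S=S_1\supset\cdots\supset S_{n+1}=\emptyset$ and there are groups $G_1,\dots,G_n$ with $S_i/S_{i+1}\cong G_i^{\theta}$ for all $i$, such that each $G_i$ is a Higman group or is isomorphic to one of the cyclic groups $C_5$, $C_8$, $C_{12}$, and $G_i$ is isomorphic to $C_5$, $C_8$ or $C_{12}$ for at most one index $i$. Moreover, for every principal series and groups $G_1,\dots,G_n$ as in (b), $S$ is an inverse semigroup (every $a\in S$ has exactly one $b\in S$ with $aba=a$ and $bab=b$), and $S$ is the disjoint union of subsemigroups $H_1,\dots,H_n$ with $H_i\cong G_i$. -/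

import Mathlib

universe u v

/-! ## Algebras -/

section Algebras

/-- `positivePower a n` is the power `a ^ (n + 1)`; it needs no identity element. -/
def positivePower {A : Type v} [Mul A] (a : A) : ℕ → A
  | 0 => a
  | n + 1 => positivePower a n * a

/-- A (possibly non-unital) ring is nilpotent free if its only nilpotent element is `0`. -/
def NilpotentFree (A : Type v) [NonUnitalRing A] : Prop :=
  ∀ (a : A) (n : ℕ), positivePower a n = 0 → a = 0

/-- A `ℤ`-order in a `ℚ`-algebra `A` with identity: a subring containing the identity of `A`,
finitely generated as a `ℤ`-module, which spans `A` over `ℚ`. -/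
structure IsZOrder {A : Type v} [Ring A] [Module ℚ A] (Γ : Subring A) : Prop where
  fg : Γ.toAddSubgroup.FG
  span_eq_top : Submodule.span ℚ (Γ : Set A) = ⊤

/-- The hyperbolic property of a `ℚ`-algebra `A` with identity: for every `ℤ`-order `Γ` of `A`, the
unit group of `Γ` contains no copy of `ℤ²`. -/
def HasHyperbolicProperty (A : Type v) [Ring A] [Module ℚ A] : Prop :=
  ∀ Γ : Subring A, IsZOrder Γ →
    ¬ ∃ f : Multiplicative (ℤ × ℤ) →* (↥Γ)ˣ, Function.Injective f

/-- The unital ring structure on a ring in which `e` is an identity element. -/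
abbrev ringOfIdentity {A : Type v} [NonUnitalRing A] (e : A)
    (he : ∀ a : A, e * a = a ∧ a * e = a) : Ring A :=
  { (inferInstance : NonUnitalRing A) with
    one := e
    one_mul := fun a => (he a).1
    mul_one := fun a => (he a).2 }

/-- `A` has an identity element, and with it the hyperbolic property. -/
def IsUnitalWithHyperbolicProperty (A : Type v) [NonUnitalRing A] [Module ℚ A] : Prop :=
  ∃ (e : A) (he : ∀ a : A, e * a = a ∧ a * e = a),
    letI : Ring A := ringOfIdentity e he
    HasHyperbolicProperty A

end Algebras

/-! ## Groups -/

section Groups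

/-- A Hamiltonian 2-group: a nonabelian 2-group all of whose subgroups are normal. -/
def IsHamiltonianTwoGroup (G : Type v) [Group G] : Prop :=
  IsPGroup 2 G ∧ (¬ ∀ a b : G, a * b = b * a) ∧ ∀ H : Subgroup G, H.Normal

/-- A Higman group: a finite group which is abelian of exponent dividing 4 or 6, or a Hamiltonian
2-group. -/
def IsHigmanGroup (G : Type v) [Group G] : Prop :=
  Finite G ∧
    (((∀ a b : G, a * b = b * a) ∧ (Monoid.exponent G ∣ 4 ∨ Monoid.exponent G ∣ 6)) ∨
      IsHamiltonianTwoGroup G)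

/-- `G` is cyclic of order 5, 8 or 12. -/
def IsC5OrC8OrC12 (G : Type v) [Group G] : Prop :=
  Nonempty (G ≃* Multiplicative (ZMod 5)) ∨ Nonempty (G ≃* Multiplicative (ZMod 8)) ∨
    Nonempty (G ≃* Multiplicative (ZMod 12))

end Groups

/-! ## Semigroups -/

section Semigroups

variable {S : Type u} [Semigroup S]

/-- `J` is a (possibly empty) two-sided ideal of the subsemigroup `T`. -/
def IsIdealOf (T J : Set S) : Prop :=
  J ⊆ T ∧ ∀ t ∈ T, ∀ x ∈ J, t * x ∈ J ∧ x * t ∈ J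

/-- `I` is a maximal ideal of `T`. -/
def IsMaximalIdealOf (T I : Set S) : Prop :=
  IsIdealOf T I ∧ I ≠ T ∧ ∀ J : Set S, IsIdealOf T J → I ⊆ J → J = I ∨ J = T

/-- A chain `S = C 0 ⊃ C 1 ⊃ ⋯ ⊃ C n = ∅` of ideals of `S`, each a maximal ideal of the previous
one. -/
structure IsPrincipalSeries {n : ℕ} (C : Fin (n + 1) → Set S) : Prop where
  zero_eq : C 0 = Set.univ
  last_eq : C (Fin.last n) = ∅
  isIdeal : ∀ i : Fin (n + 1), IsIdealOf Set.univ (C i)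
  isMaximal : ∀ i : Fin n, IsMaximalIdealOf (C i.castSucc) (C i.succ)

/-- The Rees factor `T / I`: the set `T \ I` together with a new zero element. -/
inductive ReesFactor (T I : Set S) : Type u
  | zero : ReesFactor T I
  | of (a : S) (ha : a ∈ T \ I) : ReesFactor T I

open Classical in
/-- The product of two elements of `T \ I` is their product in `S` if this is outside `I`, and zero
otherwise. (If `T` is an ideal of `S`, then `a * b ∈ T \ I` means `a * b ∉ I`.) -/
noncomputable def ReesFactor.mul {T I : Set S} : ReesFactor T I → ReesFactor T I → ReesFactor T I
  | .of a _, .of b _ => if h : a * b ∈ T \ I then .of (a * b) h else .zero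
  | .of _ _, .zero => .zero
  | .zero, _ => .zero

noncomputable instance (T I : Set S) : Mul (ReesFactor T I) where
  mul := ReesFactor.mul

/-- `C` is a principal series of `S` whose `i`-th factor is the group `G i` with a zero adjoined,
each `G i` is a Higman group or one of `C₅`, `C₈`, `C₁₂`, and the latter happens for at most one
index. -/
structure IsHigmanSeries {n : ℕ} (C : Fin (n + 1) → Set S) (G : Fin n → Type u)
    [∀ i, Group (G i)] : Prop where
  isPrincipalSeries : IsPrincipalSeries C
  factor_iso : ∀ i : Fin n,
    Nonempty (ReesFactor (C i.castSucc) (C i.succ) ≃* WithZero (G i))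
  group_type : ∀ i : Fin n, IsHigmanGroup (G i) ∨ IsC5OrC8OrC12 (G i)
  exceptional_unique : ∀ i j : Fin n, IsC5OrC8OrC12 (G i) → IsC5OrC8OrC12 (G j) → i = j

/-- Every element has a unique inverse. -/
def IsInverseSemigroup (S : Type u) [Semigroup S] : Prop :=
  ∀ a : S, ∃! b : S, a * b * a = a ∧ b * a * b = b

/-- `S` is the disjoint union of subsemigroups isomorphic to the groups `G i`. -/
def IsDisjointUnionOfGroups (S : Type u) [Semigroup S] {n : ℕ} (G : Fin n → Type u)
    [∀ i, Group (G i)] : Prop :=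
  ∃ H : Fin n → Subsemigroup S,
    (∀ i j, i ≠ j → Disjoint (H i : Set S) (H j : Set S)) ∧
    (⋃ i, (H i : Set S)) = Set.univ ∧
    ∀ i, Nonempty (↥(H i) ≃* G i)

end Semigroups

section Stratification

variable {S : Type u} [Semigroup S]

/-- `S` is the disjoint union of the images of the groups `G i`, and products descend along the
indices. -/
structure IsGroupStratification {n : ℕ} {G : Fin n → Type u} [∀ i, Group (G i)]
    (ι : ∀ i, G i →ₙ* S) : Prop where
  bijective : Function.Bijective fun p : (Σ i, G i) => ι p.1 p.2
  mul_mem : ∀ i j (g : G i) (h : G j), ∃ k, i ≤ k ∧ j ≤ k ∧ ∃ l : G k, ι i g * ι j h = ι k l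

theorem reesFactor_zero_mul {T I : Set S} (x : ReesFactor T I) :
    (ReesFactor.zero : ReesFactor T I) * x = .zero := by
  cases x <;> rfl

open Classical in
theorem reesFactor_of_mul_of {T I : Set S} {a b : S} (ha : a ∈ T \ I) (hb : b ∈ T \ I) :
    ReesFactor.of a ha * ReesFactor.of b hb =
      if h : a * b ∈ T \ I then ReesFactor.of (a * b) h else .zero := rfl

theorem IsPrincipalSeries.antitone {n : ℕ} {C : Fin (n + 1) → Set S} (hC : IsPrincipalSeries C) :
    Antitone C :=
  Fin.antitone_iff_succ_le.2 fun i => (hC.isMaximal i).1.1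

/-- The elements of the group of a Rees factor isomorphic to a group with zero. -/
theorem exists_mulHom_of_reesFactor_equiv {T I : Set S} {G : Type u} [Group G]
    (f : ReesFactor T I ≃* WithZero G) :
    ∃ ι : G →ₙ* S, Function.Injective ι ∧ Set.range ι = T \ I := by
  have hz : f .zero = 0 := by
    have h := reesFactor_zero_mul (f.symm 0 : ReesFactor T I)
    have h2 := congrArg f h
    rw [map_mul, MulEquiv.apply_symm_apply, mul_zero] at h2
    exact h2.symm
  have h1 : ∀ g : G, ∃ a, ∃ ha : a ∈ T \ I, f.symm (g : WithZero G) = .of a ha := by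
    intro g
    rcases hx : f.symm (g : WithZero G) with _ | ⟨a, ha⟩
    · have : (g : WithZero G) = f .zero := by rw [← hx, MulEquiv.apply_symm_apply]
      rw [hz] at this
      exact absurd this WithZero.coe_ne_zero
    · exact ⟨a, ha, rfl⟩
  choose φ hφ hφ2 using h1
  refine ⟨⟨φ, fun g h => ?_⟩, fun g h hgh => ?_, ?_⟩
  · have h3 := hφ2 (g * h)
    rw [WithZero.coe_mul, map_mul, hφ2, hφ2, reesFactor_of_mul_of] at h3
    split_ifs at h3 with h4
    exact (ReesFactor.of.inj h3).symm
  · have hgh' : φ g = φ h := hgh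
    have : f.symm (g : WithZero G) = f.symm (h : WithZero G) := by
      rw [hφ2, hφ2]; congr 1
    exact WithZero.coe_injective (f.symm.injective this)
  · ext a
    constructor
    · rintro ⟨g, rfl⟩
      exact hφ g
    · intro ha
      rcases hx : f (.of a ha) with _ | g
      · have h5 : f (.of a ha) = f .zero := by rw [hz]; exact hx
        exact absurd (f.injective h5) (by simp)
      · refine ⟨g, ?_⟩
        have h5 : f.symm (g : WithZero G) = .of a ha := by
          rw [MulEquiv.symm_apply_eq]; exact hx.symm
        rw [hφ2] at h5
        exact ReesFactor.of.inj h5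

theorem exists_stratification_of_series {n : ℕ} {C : Fin (n + 1) → Set S} {G : Fin n → Type u}
    [∀ i, Group (G i)] (hC : IsPrincipalSeries C)
    (hG : ∀ i : Fin n, Nonempty (ReesFactor (C i.castSucc) (C i.succ) ≃* WithZero (G i))) :
    ∃ ι : ∀ i, G i →ₙ* S, IsGroupStratification ι := by
  choose ι hinj hran using fun i => exists_mulHom_of_reesFactor_equiv (hG i).some
  have hmem : ∀ (i : Fin n) (g : G i), ι i g ∈ C i.castSucc \ C i.succ := fun i g =>
    hran i ▸ ⟨g, rfl⟩
  have hlt : ∀ (i k : Fin n) (x : S), x ∈ C i.castSucc → x ∈ C k.castSucc \ C k.succ → i ≤ k := by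
    intro i k x hx hk
    by_contra! h
    exact hk.2 (hC.antitone (Fin.le_castSucc_iff.2 (by simpa using h)) hx)
  have hcov : ∀ x : S, ∃ i : Fin n, x ∈ C i.castSucc \ C i.succ := by
    intro x
    by_contra! h
    have : ∀ i, x ∈ C i := by
      intro i
      induction i using Fin.induction with
      | zero => rw [hC.zero_eq]; trivial
      | succ i ih =>
        by_contra h2
        exact h i ⟨ih, h2⟩
    have h3 := this (Fin.last n)
    rw [hC.last_eq] at h3
    exact h3
  refine ⟨ι, ⟨⟨?_, ?_⟩, ?_⟩⟩
  · rintro ⟨i, g⟩ ⟨j, h⟩ hgh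
    have hgh' : ι i g = ι j h := hgh
    have hij : i = j := le_antisymm (hlt i j _ (hmem i g).1 (hgh' ▸ hmem j h))
      (hlt j i _ (hmem j h).1 (hgh' ▸ hmem i g))
    subst hij
    rw [hinj i hgh']
  · intro x
    obtain ⟨i, hi⟩ := hcov x
    rw [← hran] at hi
    obtain ⟨g, hg⟩ := hi
    exact ⟨⟨i, g⟩, hg⟩
  · intro i j g h
    obtain ⟨k, hk⟩ := hcov (ι i g * ι j h)
    have hk2 := hk
    rw [← hran] at hk2
    obtain ⟨l, hl⟩ := hk2
    exact ⟨k, hlt i k _ ((hC.isIdeal i.castSucc).2 _ trivial _ (hmem i g).1).2 hk,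
      hlt j k _ ((hC.isIdeal j.castSucc).2 _ trivial _ (hmem j h).1).1 hk, l, hl.symm⟩

namespace IsGroupStratification

variable {n : ℕ} {G : Fin n → Type u} [∀ i, Group (G i)] {ι : ∀ i, G i →ₙ* S}

theorem exists_eq (hι : IsGroupStratification ι) (s : S) : ∃ i g, s = ι i g := by
  obtain ⟨⟨i, g⟩, h⟩ := hι.bijective.2 s
  exact ⟨i, g, h.symm⟩

theorem index_eq (hι : IsGroupStratification ι) {i j : Fin n} {g : G i} {h : G j}
    (e : ι i g = ι j h) : i = j :=
  congrArg Sigma.fst (hι.bijective.1 (a₁ := ⟨i, g⟩) (a₂ := ⟨j, h⟩) e)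

theorem injective (hι : IsGroupStratification ι) (i : Fin n) : Function.Injective (ι i) := by
  intro g h e
  have := hι.bijective.1 (a₁ := ⟨i, g⟩) (a₂ := ⟨i, h⟩) e
  simpa using this

theorem le_of_mul_left (hι : IsGroupStratification ι) {i k : Fin n} {g : G i} {l : G k} {s : S}
    (e : ι i g * s = ι k l) : i ≤ k := by
  obtain ⟨j, h, rfl⟩ := hι.exists_eq s
  obtain ⟨k', h1, h2, l', hl⟩ := hι.mul_mem i j g h
  rw [hι.index_eq (e.symm.trans hl)]
  exact h1

theorem le_of_mul_right (hι : IsGroupStratification ι) {i k : Fin n} {g : G i} {l : G k} {s : S}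
    (e : s * ι i g = ι k l) : i ≤ k := by
  obtain ⟨j, h, rfl⟩ := hι.exists_eq s
  obtain ⟨k', h1, h2, l', hl⟩ := hι.mul_mem j i h g
  rw [hι.index_eq (e.symm.trans hl)]
  exact h2

/-- The product of the identities of two of the groups is the identity of a third. -/
theorem exists_one_mul_one (hι : IsGroupStratification ι) (i j : Fin n) :
    ∃ k, ι i 1 * ι j 1 = ι k 1 ∧ ι j 1 * ι i 1 = ι k 1 := by
  have hi : ι i 1 * ι i 1 = ι i 1 := by rw [← map_mul, one_mul]
  have hj : ι j 1 * ι j 1 = ι j 1 := by rw [← map_mul, one_mul]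
  obtain ⟨k, -, -, a, ha⟩ := hι.mul_mem i j 1 1
  obtain ⟨l, -, -, b, hb⟩ := hι.mul_mem j i 1 1
  have hle : ∀ (i j k l : Fin n) (a : G k) (b : G l), ι i 1 * ι j 1 = ι k a →
      ι j 1 * ι i 1 = ι l b → k ≤ l := by
    intro i j k l a b ha hb
    obtain ⟨m, -, hm, c, hc⟩ := hι.mul_mem j k 1 a
    refine hm.trans (hι.le_of_mul_left (g := c) (s := ι i 1) (l := b * b) ?_)
    rw [← hc, ← ha, map_mul, ← hb]
    simp only [mul_assoc]
  have hkl : k = l := le_antisymm (hle i j k l a b ha hb) (hle j i l k b a hb ha)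
  subst hkl
  have key : ∀ (i j : Fin n) (a : G k), ι i 1 * ι i 1 = ι i 1 → ι j 1 * ι j 1 = ι j 1 →
      ι i 1 * ι j 1 = ι k a → ι i 1 * ι k 1 = ι k 1 ∧ ι k 1 * ι j 1 = ι k 1 := by
    intro i j a hi hj ha
    constructor
    · have h1 : ι k 1 = ι k a * ι k a⁻¹ := by rw [← map_mul, mul_inv_cancel]
      rw [h1, ← ha, mul_assoc, ← mul_assoc, hi]
    · have h1 : ι k 1 = ι k a⁻¹ * ι k a := by rw [← map_mul, inv_mul_cancel]
      rw [h1, ← ha, mul_assoc, mul_assoc, hj]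
  obtain ⟨h1, h2⟩ := key i j a hi hj ha
  obtain ⟨h3, h4⟩ := key j i b hj hi hb
  refine ⟨k, ?_, ?_⟩
  · rw [ha, ← mul_one a, map_mul, ← ha, mul_assoc, h3, h1]
  · rw [hb, ← mul_one b, map_mul, ← hb, mul_assoc, h1, h3]

/-- The identities of the groups are central in `S`. -/
theorem one_comm (hι : IsGroupStratification ι) (j : Fin n) (s : S) :
    ι j 1 * s = s * ι j 1 := by
  obtain ⟨i, g, rfl⟩ := hι.exists_eq s
  obtain ⟨k, h1, h2⟩ := hι.exists_one_mul_one i j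
  have hr : ι i g * ι j 1 = ι i g * ι k 1 := by
    rw [← h1, ← mul_assoc, ← map_mul, mul_one]
  have hl : ι j 1 * ι i g = ι k 1 * ι i g := by
    rw [← h2, mul_assoc, ← map_mul, one_mul]
  have hik : ι i 1 * ι k 1 = ι k 1 := by rw [← h1, ← mul_assoc, ← map_mul, one_mul]
  have hki : ι k 1 * ι i 1 = ι k 1 := by rw [← h2, mul_assoc, ← map_mul, one_mul]
  have h3 : ∃ l, ι i g * ι k 1 = ι k l := by
    obtain ⟨m, -, hm, l, hl⟩ := hι.mul_mem i k g 1
    have : m = k := by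
      refine le_antisymm ?_ hm
      refine hι.le_of_mul_right (g := l) (s := ι i g⁻¹) (l := 1) ?_
      rw [← hl, ← mul_assoc, ← map_mul, inv_mul_cancel, hik]
    subst this
    exact ⟨l, hl⟩
  have h4 : ∃ l, ι k 1 * ι i g = ι k l := by
    obtain ⟨m, hm, -, l, hl⟩ := hι.mul_mem k i 1 g
    have : m = k := by
      refine le_antisymm ?_ hm
      refine hι.le_of_mul_left (g := l) (s := ι i g⁻¹) (l := 1) ?_
      rw [← hl, mul_assoc, ← map_mul, mul_inv_cancel, hki]
    subst this
    exact ⟨l, hl⟩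
  obtain ⟨l, hl3⟩ := h3
  obtain ⟨l', hl4⟩ := h4
  have e1 : ι k 1 * (ι i g * ι k 1) = ι i g * ι k 1 := by rw [hl3, ← map_mul, one_mul]
  have e2 : (ι k 1 * ι i g) * ι k 1 = ι k 1 * ι i g := by rw [hl4, ← map_mul, mul_one]
  rw [hr, hl, ← e1, ← mul_assoc, e2]

theorem isInverseSemigroup (hι : IsGroupStratification ι) : IsInverseSemigroup S := by
  have hid : ∀ e : S, e * e = e → ∃ i, e = ι i 1 := by
    intro e he
    obtain ⟨i, g, rfl⟩ := hι.exists_eq e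
    rw [← map_mul] at he
    have := hι.injective i he
    exact ⟨i, by rw [mul_eq_left.1 this]⟩
  have hc : ∀ e s : S, e * e = e → e * s = s * e := by
    intro e s he
    obtain ⟨i, rfl⟩ := hid e he
    exact hι.one_comm i s
  intro a
  obtain ⟨i, g, rfl⟩ := hι.exists_eq a
  refine ⟨ι i g⁻¹, by simp [← map_mul], ?_⟩
  rintro b ⟨h1, h2⟩
  set a := ι i g
  set c := ι i g⁻¹
  have h3 : a * c * a = a := by simp [a, c, ← map_mul]
  have h4 : c * a * c = c := by simp [a, c, ← map_mul]
  have i1 : (b * a) * (b * a) = b * a := by rw [← mul_assoc, h2]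
  have i2 : (a * b) * (a * b) = a * b := by rw [← mul_assoc, h1]
  have i3 : a * b = a * c := by
    calc a * b = (a * c) * (a * b) := by rw [← mul_assoc, h3]
      _ = (a * b) * (a * c) := (hc _ _ i2).symm
      _ = a * c := by rw [← mul_assoc, h1]
  have i4 : b * a = c * a := by
    calc b * a = (b * a) * (c * a) := by rw [mul_assoc, ← mul_assoc a, h3]
      _ = (c * a) * (b * a) := hc _ _ i1
      _ = c * a := by rw [mul_assoc, ← mul_assoc a, h1]
  rw [← h2, i4, mul_assoc, i3, ← mul_assoc, h4]

theorem isDisjointUnionOfGroups (hι : IsGroupStratification ι) :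
    IsDisjointUnionOfGroups S G := by
  refine ⟨fun i => (ι i).srange, fun i j hij => ?_, ?_, fun i => ?_⟩
  · rw [Set.disjoint_left]
    rintro _ ⟨g, rfl⟩ ⟨h, e⟩
    exact hij (hι.index_eq e).symm
  · ext s
    obtain ⟨i, g, rfl⟩ := hι.exists_eq s
    simp only [Set.mem_iUnion, Set.mem_univ, iff_true]
    exact ⟨i, g, rfl⟩
  · exact ⟨(MulEquiv.ofBijective (ι i).srangeRestrict
      ⟨fun g h e => hι.injective i (congrArg Subtype.val e), (ι i).srangeRestrict_surjective⟩).symm⟩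

end IsGroupStratification

end Stratification

section PositivePower

variable {A : Type v}

theorem positivePower_add [Semigroup A] (a : A) (m n : ℕ) :
    positivePower a (m + n + 1) = positivePower a m * positivePower a n := by
  induction n with
  | zero => rfl
  | succ n ih =>
    change positivePower a (m + n + 1) * a = positivePower a m * (positivePower a n * a)
    rw [ih, mul_assoc]

theorem NilpotentFree.eq_zero_of_mul_self {A : Type v} [NonUnitalRing A] (h : NilpotentFree A)
    {a : A} (ha : a * a = 0) : a = 0 :=
  h a 1 ha

theorem NilpotentFree.commute_of_isIdempotentElem {A : Type v} [NonUnitalRing A]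
    (h : NilpotentFree A) {e : A} (he : e * e = e) (x : A) : e * x = x * e := by
  have h1 : e * x - e * x * e = 0 := by
    apply h.eq_zero_of_mul_self
    have h3 : (e * x - e * x * e) * e = 0 := by rw [sub_mul, mul_assoc (e * x), he, sub_self]
    calc (e * x - e * x * e) * (e * x - e * x * e)
        = (e * x - e * x * e) * e * (x - x * e) := by
          rw [mul_assoc (e * x - e * x * e) e, mul_sub e, ← mul_assoc e x]
      _ = 0 := by rw [h3, zero_mul]
  have h1' : x * e - e * x * e = 0 := by
    apply h.eq_zero_of_mul_self
    have h3 : e * (x * e - e * x * e) = 0 := by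
      rw [mul_sub, ← mul_assoc, ← mul_assoc, ← mul_assoc, he, sub_self]
    calc (x * e - e * x * e) * (x * e - e * x * e)
        = (x - e * x) * (e * (x * e - e * x * e)) := by
          rw [← mul_assoc (x - e * x), sub_mul x]
      _ = 0 := by rw [h3, mul_zero]
  rw [sub_eq_zero.1 h1, sub_eq_zero.1 h1']

end PositivePower

section MaximalSubgroup

variable {S : Type u} [Semigroup S]

/-- The maximal subgroup of a semigroup at an idempotent. -/
def MaximalSubgroup {e : S} (_ : e * e = e) : Type u :=
  {a : S // e * a = a ∧ a * e = a ∧ ∃ b, e * b = b ∧ b * e = b ∧ b * a = e ∧ a * b = e}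

variable {e : S} (he : e * e = e)

theorem MaximalSubgroup.mul_mem {e a a' : S}
    (h : e * a = a ∧ a * e = a ∧ ∃ b, e * b = b ∧ b * e = b ∧ b * a = e ∧ a * b = e)
    (h' : e * a' = a' ∧ a' * e = a' ∧ ∃ b, e * b = b ∧ b * e = b ∧ b * a' = e ∧ a' * b = e) :
    e * (a * a') = a * a' ∧ a * a' * e = a * a' ∧
      ∃ b, e * b = b ∧ b * e = b ∧ b * (a * a') = e ∧ a * a' * b = e := by
  obtain ⟨h1, h2, b, h3, h4, h5, h6⟩ := h
  obtain ⟨h1', h2', b', h3', h4', h5', h6'⟩ := h'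
  refine ⟨by rw [← mul_assoc, h1], by rw [mul_assoc, h2'], b' * b, by rw [← mul_assoc, h3'],
    by rw [mul_assoc, h4], ?_, ?_⟩
  · rw [mul_assoc, ← mul_assoc b, h5, h1', h5']
  · rw [mul_assoc, ← mul_assoc a', h6', h3, h6]

noncomputable instance : Group (MaximalSubgroup he) :=
  letI : Mul (MaximalSubgroup he) := ⟨fun x y => ⟨x.1 * y.1, MaximalSubgroup.mul_mem x.2 y.2⟩⟩
  letI : One (MaximalSubgroup he) := ⟨⟨e, he, he, e, he, he, he, he⟩⟩
  letI : Inv (MaximalSubgroup he) := ⟨fun x => ⟨x.2.2.2.choose,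
    x.2.2.2.choose_spec.1, x.2.2.2.choose_spec.2.1, x.1, x.2.1, x.2.2.1,
    x.2.2.2.choose_spec.2.2.2, x.2.2.2.choose_spec.2.2.1⟩⟩
  Group.ofLeftAxioms (fun _ _ _ => Subtype.ext (mul_assoc _ _ _)) (fun x => Subtype.ext x.2.1)
    (fun x => Subtype.ext x.2.2.2.choose_spec.2.2.1)

/-- The inclusion of a maximal subgroup. -/
def MaximalSubgroup.incl : MaximalSubgroup he →ₙ* S where
  toFun := Subtype.val
  map_mul' _ _ := rfl

end MaximalSubgroup

section Clifford

variable {S : Type u} [Semigroup S]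

open MonoidAlgebra in
theorem NilpotentFree.idempotent_comm (h : NilpotentFree (MonoidAlgebra ℚ S)) {e : S}
    (he : e * e = e) (s : S) : e * s = s * e := by
  have := h.commute_of_isIdempotentElem (e := single e (1 : ℚ))
    (by rw [single_mul_single, he, one_mul]) (single s 1)
  rw [single_mul_single, single_mul_single] at this
  exact single_left_injective (by norm_num) this

open MonoidAlgebra in
theorem NilpotentFree.exists_positivePower_eq [Finite S]
    (h : NilpotentFree (MonoidAlgebra ℚ S)) (a : S) : ∃ p, positivePower a (p + 1) = a := by
  obtain ⟨m, n, hmn, hmn2⟩ := Finite.exists_ne_map_eq_of_infinite (positivePower a)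
  wlog hlt : m < n generalizing m n
  · exact this n m hmn.symm hmn2.symm (by omega)
  obtain ⟨p, rfl⟩ := Nat.exists_eq_add_of_lt hlt
  clear hlt hmn
  induction m with
  | zero => exact ⟨p, by simpa [positivePower] using hmn2.symm⟩
  | succ m ih =>
    apply ih
    have h1 : ∀ k, positivePower a (k + 1) = a * positivePower a k := fun k => by
      simpa [positivePower] using positivePower_add a 0 k
    set x : MonoidAlgebra ℚ S := single (positivePower a m) 1
    set y : MonoidAlgebra ℚ S := single (positivePower a (m + p + 1)) 1
    have h2 : (x - y) * single a 1 = 0 := by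
      rw [sub_mul, single_mul_single, single_mul_single, sub_eq_zero]
      change single (positivePower a (m + 1)) _ = single (positivePower a (m + p + 1 + 1)) _
      rw [hmn2]; congr 2; omega
    have h3 : ∀ k, (x - y) * single (positivePower a k) 1 = 0 := by
      intro k
      cases k with
      | zero => exact h2
      | succ k => rw [h1, ← one_mul (1 : ℚ), ← single_mul_single, ← mul_assoc, h2, zero_mul]
    have h4 : x - y = 0 := h.eq_zero_of_mul_self (by rw [mul_sub, h3, h3, sub_zero])
    exact single_left_injective (one_ne_zero) (sub_eq_zero.1 h4)

theorem mem_maximalSubgroup_of_positivePower_eq {a : S} {p : ℕ} (h : positivePower a (p + 1) = a) :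
    ∃ e : S, e * e = e ∧ e * a = a ∧ a * e = a ∧
      ∃ b, e * b = b ∧ b * e = b ∧ b * a = e ∧ a * b = e := by
  have h0 : positivePower a p * a = a := h
  have h1 : ∀ k, positivePower a (k + 1) = a * positivePower a k := fun k => by
    simpa [positivePower] using positivePower_add a 0 k
  have h2 : a * positivePower a p = a := (h1 p).symm.trans h
  have h3 : ∀ k, positivePower a p * positivePower a k = positivePower a k := by
    intro k
    cases k with
    | zero => exact h0
    | succ k => rw [h1, ← mul_assoc, h0]
  have h4 : ∀ k, positivePower a k * positivePower a p = positivePower a k := by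
    intro k
    cases k with
    | zero => exact h2
    | succ k => change positivePower a k * a * _ = _ * _; rw [mul_assoc, h2]
  refine ⟨positivePower a p, h3 p, h0, h2, positivePower a (p + p), h3 _, h4 _, ?_, ?_⟩
  · change positivePower a (p + p + 1) = _
    rw [positivePower_add, h3]
  · rw [← h1, positivePower_add, h3]

theorem exists_stratification_of_nilpotentFree [Finite S]
    (h : NilpotentFree (MonoidAlgebra ℚ S)) :
    ∃ (n : ℕ) (G : Fin n → Type u) (_ : ∀ i, Group (G i)) (ι : ∀ i, G i →ₙ* S),
      IsGroupStratification ι := by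
  classical
  let E := {e : S // e * e = e}
  let _ : PartialOrder E :=
    { le := fun e f => e.1 * f.1 = f.1
      le_refl := fun e => e.2
      le_trans := fun e f g hef hfg => by
        rw [← show f.1 * g.1 = g.1 from hfg, ← mul_assoc, show e.1 * f.1 = f.1 from hef]
      le_antisymm := fun e f hef hfe => Subtype.ext <| by
        rw [← show f.1 * e.1 = e.1 from hfe, h.idempotent_comm f.2]; exact hef }
  have : Fintype (LinearExtension E) := Fintype.ofFinite E
  let n := Fintype.card (LinearExtension E)
  let r : Fin n ≃o LinearExtension E := monoEquivOfFin _ rfl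
  let ε : Fin n → E := fun i => r i
  have hle : ∀ i j, (ε i).1 * (ε j).1 = (ε j).1 → i ≤ j := fun i j hij => by
    have := toLinearExtension.monotone (show ε i ≤ ε j from hij)
    exact r.le_iff_le.1 this
  have hsurj : ∀ e : S, e * e = e → ∃ i, (ε i).1 = e := fun e he =>
    ⟨r.symm (⟨e, he⟩ : E), by
      have : r (r.symm (⟨e, he⟩ : E)) = (⟨e, he⟩ : E) := r.apply_symm_apply _
      exact congrArg Subtype.val this⟩
  refine ⟨n, fun i => MaximalSubgroup (ε i).2, inferInstance,
    fun i => MaximalSubgroup.incl (ε i).2, ⟨?_, ?_⟩, ?_⟩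
  · have key : ∀ {i j} (x : MaximalSubgroup (ε i).2) (y : MaximalSubgroup (ε j).2),
        x.1 = y.1 → (ε i).1 * (ε j).1 = (ε j).1 := by
      rintro i j ⟨a, h1, _⟩ ⟨a', _, _, b', _, _, _, h6'⟩ hxy
      change a = a' at hxy
      rw [← h6', ← mul_assoc, ← hxy, h1]
    rintro ⟨i, x⟩ ⟨j, y⟩ (hxy : x.1 = y.1)
    have hij : i = j := le_antisymm (hle _ _ (key x y hxy)) (hle _ _ (key y x hxy.symm))
    subst hij
    rw [Subtype.ext hxy]
  · intro a
    obtain ⟨p, hp⟩ := h.exists_positivePower_eq a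
    obtain ⟨e, he, h2⟩ := mem_maximalSubgroup_of_positivePower_eq hp
    obtain ⟨i, rfl⟩ := hsurj e he
    exact ⟨⟨i, ⟨a, h2⟩⟩, rfl⟩
  · rintro i j ⟨a, h1, h2, b, h3, h4, h5, h6⟩ ⟨a', h1', h2', b', h3', h4', h5', h6'⟩
    have hi := (ε i).2
    have hj := (ε j).2
    set e := (ε i).1
    set f := (ε j).1
    have hcf : ∀ s, f * s = s * f := h.idempotent_comm hj
    have hce : ∀ s, e * s = s * e := h.idempotent_comm hi
    have hef : e * f * (e * f) = e * f := by
      rw [mul_assoc, ← mul_assoc f, hcf e, mul_assoc e f f, hj, ← mul_assoc, hi]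
    obtain ⟨k, hk⟩ := hsurj _ hef
    have m1 : ∀ {s t}, e * s = s → f * t = t → e * f * (s * t) = s * t := by
      intro s t hs ht
      rw [mul_assoc, ← mul_assoc f, hcf s, mul_assoc, ht, ← mul_assoc, hs]
    have m2 : ∀ {s t}, e * s = s → f * t = t → s * t * (e * f) = s * t := by
      intro s t hs ht
      rw [← h.idempotent_comm hef, m1 hs ht]
    have m3 : ∀ {s t}, f * s = s → e * t = t → e * f * (s * t) = s * t := by
      intro s t hs ht
      rw [mul_assoc, ← mul_assoc f, hs, ← mul_assoc, hce, mul_assoc, ht]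
    refine ⟨k, hle i k ?_, hle j k ?_, ⟨a * a', ?_, ?_, b' * b, ?_, ?_, ?_, ?_⟩, rfl⟩
    · rw [hk, ← mul_assoc]; exact congrArg (· * f) hi
    · rw [hk]; change f * (e * f) = _; rw [hcf, mul_assoc, hj]
    · rw [hk]; exact m1 h1 h1'
    · rw [hk]; exact m2 h1 h1'
    · rw [hk]; exact m3 h3' h3
    · rw [hk, ← h.idempotent_comm hef]; exact m3 h3' h3
    · rw [hk, mul_assoc, ← mul_assoc b, h5, ← mul_assoc, ← hce, mul_assoc, h5']
    · rw [hk, mul_assoc, ← mul_assoc a', h6', hcf, ← mul_assoc, h6]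

open Classical in
theorem IsGroupStratification.exists_series {n : ℕ} {G : Fin n → Type u} [∀ i, Group (G i)]
    {ι : ∀ i, G i →ₙ* S} (hι : IsGroupStratification ι) :
    ∃ C : Fin (n + 1) → Set S, IsPrincipalSeries C ∧
      ∀ i : Fin n, Nonempty (ReesFactor (C i.castSucc) (C i.succ) ≃* WithZero (G i)) := by
  let C : Fin (n + 1) → Set S := fun i => {s | ∃ (k : Fin n) (g : G k), i ≤ k.castSucc ∧ s = ι k g}
  have hmem : ∀ i k (g : G k), ι k g ∈ C i ↔ i ≤ k.castSucc := by
    intro i k g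
    constructor
    · rintro ⟨l, h, h1, h2⟩
      rwa [hι.index_eq h2]
    · exact fun h1 => ⟨k, g, h1, rfl⟩
  have hid : ∀ i, IsIdealOf Set.univ (C i) := by
    refine fun i => ⟨Set.subset_univ _, fun t _ x hx => ?_⟩
    obtain ⟨k, g, hk, rfl⟩ := hx
    obtain ⟨l, h, rfl⟩ := hι.exists_eq t
    obtain ⟨m, -, h2, x, hx⟩ := hι.mul_mem l k h g
    obtain ⟨m', h2', -, x', hx'⟩ := hι.mul_mem k l g h
    rw [hx, hx', hmem, hmem]
    exact ⟨hk.trans (by simpa using h2), hk.trans (by simpa using h2')⟩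
  have hanti : ∀ i : Fin n, C i.succ ⊆ C i.castSucc := by
    rintro i _ ⟨k, g, hk, rfl⟩
    rw [hmem]
    exact i.castSucc_lt_succ.le.trans hk
  have hdiff : ∀ (i : Fin n) s, s ∈ C i.castSucc \ C i.succ ↔ ∃ g, s = ι i g := by
    intro i s
    constructor
    · rintro ⟨⟨k, g, h1, rfl⟩, h2⟩
      rw [hmem, Fin.succ_le_castSucc_iff, not_lt] at h2
      have : i = k := le_antisymm (by simpa using h1) h2
      subst this
      exact ⟨g, rfl⟩
    · rintro ⟨g, rfl⟩
      refine ⟨(hmem _ _ _).2 le_rfl, ?_⟩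
      rw [hmem, Fin.succ_le_castSucc_iff]
      exact lt_irrefl i
  refine ⟨C, ⟨?_, ?_, hid, ?_⟩, ?_⟩
  · ext s
    obtain ⟨k, g, rfl⟩ := hι.exists_eq s
    simp [hmem]
  · ext s
    obtain ⟨k, g, rfl⟩ := hι.exists_eq s
    rw [hmem]
    simp
  · refine fun i => ⟨⟨hanti i, fun t _ x hx => (hid i.succ).2 t trivial x hx⟩, ?_, ?_⟩
    · intro h1
      have := (hdiff i (ι i 1)).2 ⟨1, rfl⟩
      rw [h1] at this
      exact this.2 this.1
    · intro J hJ hJ2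
      by_cases h1 : J ⊆ C i.succ
      · exact .inl (h1.antisymm hJ2)
      · refine .inr (hJ.1.antisymm fun x hx => ?_)
        rw [Set.not_subset] at h1
        obtain ⟨y, hy, hy2⟩ := h1
        obtain ⟨g, rfl⟩ := (hdiff i y).1 ⟨hJ.1 hy, hy2⟩
        by_cases hx2 : x ∈ C i.succ
        · exact hJ2 hx2
        · obtain ⟨h, rfl⟩ := (hdiff i x).1 ⟨hx, hx2⟩
          rw [← inv_mul_cancel_right h g, map_mul]
          exact (hJ.2 _ ((hmem _ _ _).2 le_rfl) _ hy).1
  · intro i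
    have hof : ∀ g, ι i g ∈ C i.castSucc \ C i.succ := fun g => (hdiff i _).2 ⟨g, rfl⟩
    let φ : WithZero (G i) → ReesFactor (C i.castSucc) (C i.succ)
      | 0 => .zero
      | (g : G i) => .of (ι i g) (hof g)
    have hφ0 : φ 0 = .zero := rfl
    have hφ : ∀ g : G i, φ g = .of (ι i g) (hof g) := fun g => rfl
    refine ⟨(MulEquiv.ofBijective (⟨φ, ?_⟩ : WithZero (G i) →ₙ* _) ⟨?_, ?_⟩).symm⟩
    · intro x y
      induction x with
      | zero => rw [zero_mul, hφ0, reesFactor_zero_mul]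
      | coe x =>
        induction y with
        | zero => rw [mul_zero, hφ0, hφ]; rfl
        | coe y =>
          rw [← WithZero.coe_mul, hφ, hφ, hφ, reesFactor_of_mul_of]
          simp only [← map_mul, hof, dif_pos]
    · intro x y hxy
      change φ x = φ y at hxy
      induction x with
      | zero =>
        induction y with
        | zero => rfl
        | coe y => rw [hφ0, hφ] at hxy; exact absurd hxy (by simp)
      | coe x =>
        induction y with
        | zero => rw [hφ0, hφ] at hxy; exact absurd hxy (by simp)
        | coe y =>
          rw [hφ, hφ] at hxy
          rw [hι.injective i (ReesFactor.of.inj hxy)]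
    · intro y
      cases y with
      | zero => exact ⟨0, rfl⟩
      | of a ha =>
        obtain ⟨g, rfl⟩ := (hdiff i a).1 ha
        exact ⟨g, rfl⟩

end Clifford

section Transport

theorem HasHyperbolicProperty.of_ringEquiv {A B : Type*} [Ring A] [Ring B] [Module ℚ A]
    [Module ℚ B] (e : A ≃+* B) (h : HasHyperbolicProperty A) : HasHyperbolicProperty B := by
  rintro Γ ⟨hfg, hspan⟩ ⟨f, hf⟩
  refine h (Γ.map (e.symm : B →+* A)) ⟨?_, ?_⟩
    ⟨(Units.mapEquiv (e.symm.subringMap (s := Γ)).toMulEquiv).toMonoidHom.comp f,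
      (Units.mapEquiv _).injective.comp hf⟩
  · have : (Γ.map (e.symm : B →+* A)).toAddSubgroup
        = Γ.toAddSubgroup.map (e.symm : B →+* A).toAddMonoidHom := rfl
    rw [this]
    obtain ⟨s, hs⟩ := hfg
    classical
    refine ⟨s.image e.symm, ?_⟩
    rw [← hs, AddMonoidHom.map_closure, Finset.coe_image]
    rfl
  · have h1 : ((Γ.map (e.symm : B →+* A) : Subring A) : Set A)
        = (AddMonoidHom.toRatLinearMap (e.symm : B →+* A).toAddMonoidHom) '' (Γ : Set B) := rfl
    rw [h1, Submodule.span_image, hspan, Submodule.map_top, LinearMap.range_eq_top]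
    exact e.symm.surjective

theorem isUnitalWithHyperbolicProperty_iff_of_ringEquiv {A B : Type*} [NonUnitalRing A] [Ring B]
    [Module ℚ A] [Module ℚ B] (φ : A ≃+* B) :
    IsUnitalWithHyperbolicProperty A ↔ HasHyperbolicProperty B := by
  constructor
  · rintro ⟨e, he, h⟩
    let _ : Ring A := ringOfIdentity e he
    exact HasHyperbolicProperty.of_ringEquiv (A := A) (B := B)
      { toEquiv := φ.toEquiv, map_mul' := φ.map_mul, map_add' := φ.map_add } h
  · intro h
    have he : ∀ a : A, φ.symm 1 * a = a ∧ a * φ.symm 1 = a := fun a => by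
      constructor <;> apply φ.injective <;> simp
    refine ⟨φ.symm 1, he, ?_⟩
    let _ : Ring A := ringOfIdentity _ he
    exact HasHyperbolicProperty.of_ringEquiv (A := B) (B := A)
      { toEquiv := φ.symm.toEquiv, map_mul' := φ.symm.map_mul, map_add' := φ.symm.map_add } h

theorem nilpotentFree_iff_of_ringEquiv {A B : Type*} [NonUnitalRing A] [Ring B] (φ : A ≃+* B) :
    NilpotentFree A ↔ IsReduced B := by
  have hp : ∀ (a : A) n, φ (positivePower a n) = φ a ^ (n + 1) := by
    intro a n
    induction n with
    | zero => simp [positivePower]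
    | succ n ih => rw [positivePower, map_mul, ih, pow_succ _ (n + 1)]
  constructor
  · refine fun h => ⟨fun b => ?_⟩
    rintro ⟨n, hn⟩
    have := h (φ.symm b) n (φ.injective (by
      rw [hp, φ.apply_symm_apply, pow_succ, hn, zero_mul, map_zero]))
    simpa using this
  · intro h a n ha
    have h1 : φ a ^ (n + 1) = 0 := by rw [← hp, ha, map_zero]
    exact (map_eq_zero_iff φ φ.injective).1 (eq_zero_of_pow_eq_zero h1)

end Transport

section Decomposition

open MonoidAlgebra

variable {S : Type u} [Semigroup S] {n : ℕ} {G : Fin n → Type u} [∀ i, Group (G i)]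
  {ι : ∀ i, G i →ₙ* S}

namespace IsGroupStratification

open Classical in
/-- The component of an element of `S` in the group algebra of `G j`. -/
noncomputable def component (_ : IsGroupStratification ι) (s : S) (j : Fin n) :
    MonoidAlgebra ℚ (G j) :=
  if h : ∃ g, ι j 1 * s = ι j g then single h.choose 1 else 0

theorem component_eq_single (hι : IsGroupStratification ι) {s : S} {j : Fin n} {g : G j}
    (h : ι j 1 * s = ι j g) : hι.component s j = single g 1 := by
  have h' : ∃ g, ι j 1 * s = ι j g := ⟨g, h⟩
  rw [component, dif_pos h', hι.injective j (h'.choose_spec.symm.trans h)]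

theorem component_eq_zero (hι : IsGroupStratification ι) {s : S} {j : Fin n}
    (h : ¬ ∃ g, ι j 1 * s = ι j g) : hι.component s j = 0 := by
  rw [component, dif_neg h]

theorem component_mul (hι : IsGroupStratification ι) (s t : S) :
    hι.component (s * t) = hι.component s * hι.component t := by
  funext j
  rw [Pi.mul_apply]
  have hjj : ι j 1 * ι j 1 = ι j 1 := by rw [← map_mul, one_mul]
  have hmul : ι j 1 * (s * t) = (ι j 1 * s) * (ι j 1 * t) := by
    rw [mul_assoc, ← mul_assoc s, ← hι.one_comm j s, mul_assoc (ι j 1) s,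
      ← mul_assoc (ι j 1) (ι j 1), hjj]
  have key : ∀ u, ¬ (∃ g, ι j 1 * u = ι j g) →
      ∃ k, j < k ∧ ∃ h : G k, ι j 1 * u = ι k h := by
    intro u hu
    obtain ⟨k, h, hk⟩ := hι.exists_eq (ι j 1 * u)
    refine ⟨k, lt_of_le_of_ne (hι.le_of_mul_left hk) ?_, h, hk⟩
    rintro rfl
    exact hu ⟨h, hk⟩
  by_cases hs : ∃ g, ι j 1 * s = ι j g
  · obtain ⟨g, hg⟩ := hs
    by_cases ht : ∃ g, ι j 1 * t = ι j g
    · obtain ⟨h, hh⟩ := ht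
      rw [hι.component_eq_single hg, hι.component_eq_single hh,
        hι.component_eq_single (g := g * h) (by rw [hmul, hg, hh, map_mul]),
        single_mul_single, one_mul]
    · rw [hι.component_eq_zero ht, mul_zero, hι.component_eq_zero]
      rintro ⟨l, hl⟩
      obtain ⟨k, hk, h, hh⟩ := key t ht
      rw [hmul, hh] at hl
      exact hk.not_ge (hι.le_of_mul_right hl)
  · rw [hι.component_eq_zero hs, zero_mul, hι.component_eq_zero]
    rintro ⟨l, hl⟩
    obtain ⟨k, hk, h, hh⟩ := key s hs
    rw [hmul, hh] at hl
    exact hk.not_ge (hι.le_of_mul_left hl)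

/-- The homomorphism from the algebra of `S` to the product of the group algebras. -/
noncomputable def toPi (hι : IsGroupStratification ι) :
    MonoidAlgebra ℚ S →ₙₐ[ℚ] (∀ i, MonoidAlgebra ℚ (G i)) :=
  liftMagma ℚ ⟨hι.component, hι.component_mul⟩

theorem toPi_apply (hι : IsGroupStratification ι) (x : MonoidAlgebra ℚ S) :
    hι.toPi x = x.coeff.sum fun s r => r • hι.component s := by
  rw [toPi, liftMagma_apply_apply]
  rfl

theorem toPi_injective (hι : IsGroupStratification ι) : Function.Injective hι.toPi := by
  rw [injective_iff_map_eq_zero]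
  intro x hx
  by_contra hne
  have hex : ∃ i : Fin n, ∃ g : G i, x.coeff (ι i g) ≠ 0 := by
    by_contra! h
    apply hne
    ext s
    obtain ⟨i, g, rfl⟩ := hι.exists_eq s
    exact h i g
  obtain ⟨i, ⟨g, hg⟩, hmin⟩ := wellFounded_lt.has_min {i : Fin n | ∃ g : G i, x.coeff (ι i g) ≠ 0} hex
  apply hg
  have h1 := congrFun (congrArg (fun y => fun i => (y i : MonoidAlgebra ℚ (G i)).coeff) hx) i
  have h2 := DFunLike.congr_fun h1 g
  simp only [Pi.zero_apply, coeff_zero, Finsupp.coe_zero] at h2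
  rw [toPi_apply, Finsupp.sum, Finset.sum_apply, coeff_sum, Finsupp.finsetSum_apply] at h2
  rw [Finset.sum_eq_single (ι i g)] at h2
  · rw [Pi.smul_apply, coeff_smul_apply, hι.component_eq_single (g := g) (by rw [← map_mul, one_mul])]
      at h2
    simpa using h2
  · intro s hs hsg
    obtain ⟨k, h, rfl⟩ := hι.exists_eq s
    rw [Finsupp.mem_support_iff] at hs
    have hik : ¬ k < i := hmin k ⟨h, hs⟩
    rw [Pi.smul_apply, coeff_smul_apply]
    by_cases hc : ∃ g, ι i 1 * ι k h = ι i g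
    · obtain ⟨l, hl⟩ := hc
      have : k = i := le_antisymm (hι.le_of_mul_right hl) (not_lt.1 hik)
      subst this
      rw [hι.component_eq_single (g := h) (by rw [← map_mul, one_mul])]
      have : h ≠ g := fun e => hsg (by rw [e])
      simp [this]
    · rw [hι.component_eq_zero hc]
      simp
  · intro h
    rw [Finsupp.notMem_support_iff] at h
    rw [h]; simp

theorem toPi_bijective [Finite S] (hι : IsGroupStratification ι) :
    Function.Bijective hι.toPi := by
  have : Fintype S := Fintype.ofFinite S
  have : ∀ i, Finite (G i) := fun i => Finite.of_injective _ (hι.injective i)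
  have : ∀ i, Fintype (G i) := fun i => Fintype.ofFinite _
  refine ⟨hι.toPi_injective, ?_⟩
  let L : MonoidAlgebra ℚ S →ₗ[ℚ] (∀ i, MonoidAlgebra ℚ (G i)) := hι.toPi
  have hf : ∀ M : Type u, [Fintype M] → Module.Finite ℚ (MonoidAlgebra ℚ M) ∧
      Module.finrank ℚ (MonoidAlgebra ℚ M) = Fintype.card M := by
    intro M _
    have e := (coeffLinearEquiv ℚ : MonoidAlgebra ℚ M ≃ₗ[ℚ] (M →₀ ℚ))
    exact ⟨Module.Finite.equiv e.symm, by rw [e.finrank_eq, Module.finrank_finsupp_self]⟩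
  have : Module.Finite ℚ (MonoidAlgebra ℚ S) := (hf S).1
  have : ∀ i, Module.Finite ℚ (MonoidAlgebra ℚ (G i)) := fun i => (hf (G i)).1
  have hd : Module.finrank ℚ (MonoidAlgebra ℚ S)
      = Module.finrank ℚ (∀ i, MonoidAlgebra ℚ (G i)) := by
    rw [Module.finrank_pi_fintype, (hf S).2, ← Fintype.card_of_bijective hι.bijective,
      Fintype.card_sigma]
    exact Finset.sum_congr rfl fun i _ => ((hf (G i)).2).symm
  exact (LinearMap.injective_iff_surjective_of_finrank_eq_finrank (f := L) hd).1
    hι.toPi_injective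

/-- The algebra of `S` is the product of the group algebras. -/
noncomputable def ringEquivPi [Finite S] (hι : IsGroupStratification ι) :
    MonoidAlgebra ℚ S ≃+* (∀ i, MonoidAlgebra ℚ (G i)) :=
  RingEquiv.ofBijective hι.toPi hι.toPi_bijective

end IsGroupStratification

end Decomposition

section UnitRank

open NumberField NumberField.Units Module

variable (K : Type*) [Field K] [NumberField K]

theorem exists_injective_units_of_two_le_rank (h : 2 ≤ rank K) :
    ∃ f : Multiplicative (ℤ × ℤ) →* (𝓞 K)ˣ, Function.Injective f := by
  rw [← NumberField.Units.finrank_eq] at h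
  obtain ⟨w, hw⟩ := exists_linearIndependent_of_le_finrank h
  let L : ℤ × ℤ →+ Additive (𝓞 K)ˣ :=
    ((zmultiplesHom _ (w 0)).comp (AddMonoidHom.fst ℤ ℤ)) +
      ((zmultiplesHom _ (w 1)).comp (AddMonoidHom.snd ℤ ℤ))
  refine ⟨MonoidHom.toAdditiveRight.symm L, ?_⟩
  change Function.Injective L
  refine (injective_iff_map_eq_zero _).2 fun ⟨a, b⟩ hx => ?_
  have hx' : a • w 0 + b • w 1 = 0 := hx
  have h3 := Fintype.linearIndependent_iff.1 hw ![a, b] (by simpa using hx')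
  exact Prod.ext (h3 0) (h3 1)

theorem exists_unit_zpow_eq_one_imp_of_one_le_rank (h : 1 ≤ rank K) :
    ∃ u : (𝓞 K)ˣ, ∀ n : ℤ, u ^ n = 1 → n = 0 := by
  rw [← NumberField.Units.finrank_eq] at h
  obtain ⟨w, hw⟩ := exists_linearIndependent_of_le_finrank h
  refine ⟨(w 0).toMul, fun a h0 => ?_⟩
  refine Fintype.linearIndependent_iff.1 hw (fun _ => a) ?_ 0
  rw [Fin.sum_univ_one]
  exact h0

theorem not_injective_units_of_rank_le_one (h : rank K ≤ 1)
    (f : Multiplicative (ℤ × ℤ) →* (𝓞 K)ˣ) : ¬ Function.Injective f := by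
  intro hf
  let L : ℤ × ℤ →ₗ[ℤ] Additive (𝓞 K)ˣ := (MonoidHom.toAdditiveRight f).toIntLinearMap
  have hL : Function.Injective L := hf
  have := LinearMap.finrank_le_finrank_of_injective hL
  rw [NumberField.Units.finrank_eq, Module.finrank_prod, Module.finrank_self] at this
  omega

theorem rank_of_isCyclotomicExtension (n : ℕ) [NeZero n] [IsCyclotomicExtension {n} ℚ K]
    (hn : 2 < n) : rank K = n.totient / 2 - 1 := by
  rw [rank, ← IsCyclotomicExtension.Rat.nrComplexPlaces_eq_totient_div_two n K,
    InfinitePlace.card_eq_nrRealPlaces_add_nrComplexPlaces,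
    IsCyclotomicExtension.Rat.nrRealPlaces_eq_zero (n := n) K hn, zero_add]

end UnitRank

section Orders

variable {A : Type*} [Ring A] [Module ℚ A]

theorem IsZOrder.exists_nsmul_mem {Γ : Subring A} (hΓ : IsZOrder Γ) (x : A) :
    ∃ N : ℕ, 0 < N ∧ N • x ∈ Γ := by
  have hx : x ∈ Submodule.span ℚ (Γ : Set A) := by rw [hΓ.span_eq_top]; trivial
  induction hx using Submodule.span_induction with
  | mem x h => exact ⟨1, one_pos, by simpa using h⟩
  | zero => exact ⟨1, one_pos, by simp⟩
  | add x y _ _ hx hy =>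
    obtain ⟨N, hN, hx⟩ := hx
    obtain ⟨M, hM, hy⟩ := hy
    refine ⟨N * M, by positivity, ?_⟩
    rw [smul_add]
    refine Γ.add_mem ?_ ?_
    · rw [mul_comm, mul_smul]; exact Γ.nsmul_mem hx M
    · rw [mul_smul]; exact Γ.nsmul_mem hy N
  | smul q x _ hx =>
    obtain ⟨N, hN, hx⟩ := hx
    refine ⟨N * q.den, mul_pos hN q.den_pos, ?_⟩
    have : (N * q.den) • q • x = q.num • N • x := by
      rw [← Nat.cast_smul_eq_nsmul ℚ, ← Nat.cast_smul_eq_nsmul ℚ, ← Int.cast_smul_eq_zsmul ℚ,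
        smul_smul, smul_smul]
      congr 1
      push_cast
      rw [mul_assoc, mul_comm (q.den : ℚ), Rat.mul_den_eq_num, mul_comm]
    rw [this]
    exact Γ.zsmul_mem hx _

/-- A subring of the algebra which is finitely generated over `ℤ` is commensurable with a
subring of an order, so that free abelian groups of units carry over. -/
theorem IsZOrder.exists_injective_units {Γ : Subring A} (hΓ : IsZOrder Γ) {R : Type*} [CommRing R]
    [Module.Finite ℤ R] (φ : R →ₙ+* A) (hφ : Function.Injective φ)
    (f : Multiplicative (ℤ × ℤ) →* Rˣ) (hf : Function.Injective f) :
    ∃ f' : Multiplicative (ℤ × ℤ) →* (↥Γ)ˣ, Function.Injective f' := by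
  obtain ⟨N, hN, hNφ⟩ : ∃ N : ℕ, 0 < N ∧ ∀ r, N • φ r ∈ Γ := by
    obtain ⟨s, hs⟩ := Module.Finite.fg_top (R := ℤ) (M := R)
    choose N hN hNΓ using fun r => hΓ.exists_nsmul_mem (φ r)
    refine ⟨∏ r ∈ s, N r, Finset.prod_pos fun r _ => hN r, fun r => ?_⟩
    have hr : r ∈ Submodule.span ℤ (s : Set R) := by rw [hs]; trivial
    induction hr using Submodule.span_induction with
    | mem x h =>
      obtain ⟨k, hk⟩ := Finset.dvd_prod_of_mem N h
      rw [hk, mul_comm, mul_smul]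
      exact Γ.nsmul_mem (hNΓ x) k
    | zero => simp
    | add x y _ _ hx hy => rw [map_add, smul_add]; exact Γ.add_mem hx hy
    | smul a x _ hx => rw [map_zsmul, smul_comm]; exact Γ.zsmul_mem hx a
  let I : Ideal R := Ideal.span {(N : R)}
  have hfin : Finite (R ⧸ I) := by
    have : Module.Finite ℤ (R ⧸ I) :=
      Module.Finite.of_surjective (Ideal.Quotient.mk I).toAddMonoidHom.toIntLinearMap
        Ideal.Quotient.mk_surjective
    refine Module.finite_of_fg_torsion _ fun x => ?_
    refine ⟨⟨(N : ℤ), mem_nonZeroDivisors_of_ne_zero (by exact_mod_cast hN.ne')⟩, ?_⟩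
    obtain ⟨r, rfl⟩ := Ideal.Quotient.mk_surjective x
    change (N : ℤ) • Ideal.Quotient.mk I r = 0
    rw [← map_zsmul, Ideal.Quotient.eq_zero_iff_mem, Ideal.mem_span_singleton]
    exact ⟨r, by simp⟩
  obtain ⟨m, hm, hpow⟩ : ∃ m : ℕ, 0 < m ∧ ∀ u : Rˣ, ((u ^ m : Rˣ) : R) - 1 ∈ I := by
    refine ⟨Nat.card (R ⧸ I)ˣ, Nat.card_pos, fun u => ?_⟩
    rw [← Ideal.Quotient.eq_zero_iff_mem, map_sub, map_one, sub_eq_zero]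
    have := pow_card_eq_one' (x := Units.map (Ideal.Quotient.mk I : R →* R ⧸ I) u)
    rw [← map_pow] at this
    exact congrArg Units.val this
  let θ : R →* A :=
    { toFun := fun x => 1 - φ 1 + φ x
      map_one' := by simp
      map_mul' := fun x y => by
        have h1 : φ 1 * φ y = φ y := by rw [← map_mul, one_mul]
        have h2 : φ x * φ 1 = φ x := by rw [← map_mul, mul_one]
        have h3 : φ 1 * φ 1 = φ 1 := by rw [← map_mul, mul_one]
        simp only [add_mul, mul_add, sub_mul, mul_sub, one_mul, mul_one, h1, h2, h3, map_mul]
        abel }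
  have hθ : Function.Injective θ := fun x y hxy => hφ (add_left_cancel hxy)
  have hmem : ∀ u : Rˣ, θ ((u ^ m : Rˣ) : R) ∈ Γ := by
    intro u
    obtain ⟨r, hr⟩ := Ideal.mem_span_singleton.1 (hpow u)
    have h1 : θ ((u ^ m : Rˣ) : R) = 1 + N • φ r := by
      change 1 - φ 1 + φ _ = _
      rw [← map_nsmul, nsmul_eq_mul, ← hr, map_sub]
      abel
    rw [h1]
    exact Γ.add_mem Γ.one_mem (hNφ r)
  let g : Multiplicative (ℤ × ℤ) →* Γ :=
    { toFun := fun v => ⟨θ ((f v ^ m : Rˣ) : R), hmem (f v)⟩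
      map_one' := Subtype.ext (by simp)
      map_mul' := fun v w => Subtype.ext (by simp [mul_pow]) }
  refine ⟨g.toHomUnits, fun v w hvw => ?_⟩
  have h1 : g v = g w := congrArg Units.val hvw
  have h2 := Units.ext (hθ (congrArg Subtype.val h1))
  rw [← map_pow, ← map_pow] at h2
  have h3 : m • v.toAdd = m • w.toAdd := hf h2
  exact Multiplicative.toAdd.injective (smul_right_injective _ hm.ne' h3)

end Orders

section Splitting

/-- A surjective homomorphism from a commutative semisimple ring has a non-unital section. -/
theorem exists_nonUnitalRingHom_section {B C : Type*} [CommRing B] [IsSemisimpleRing B] [Ring C]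
    (π : B →+* C) (hπ : Function.Surjective π) : ∃ σ : C →ₙ+* B, ∀ c, π (σ c) = c := by
  obtain ⟨J, hJ⟩ := exists_isCompl (RingHom.ker π)
  obtain ⟨k, hk, j, hj, hkj⟩ := Submodule.mem_sup.1
    (show (1 : B) ∈ RingHom.ker π ⊔ J by rw [hJ.sup_eq_top]; trivial)
  have hker : ∀ x ∈ RingHom.ker π, x * j = 0 := fun x hx => by
    have : x * j ∈ RingHom.ker π ⊓ J :=
      ⟨Ideal.mul_mem_right _ _ hx, J.smul_mem x hj⟩
    rwa [hJ.inf_eq_bot] at this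
  have hjj : j * j = j := by
    conv_rhs => rw [← one_mul j, ← hkj, add_mul, hker k hk, zero_add]
  have hπj : π j = 1 := by
    rw [← map_one π, ← hkj, map_add, (RingHom.mem_ker).1 hk, zero_add]
  have key : ∀ a b, π a = π b → a * j = b * j := fun a b hab => by
    rw [← sub_eq_zero, ← sub_mul]
    exact hker _ (by rw [RingHom.mem_ker, map_sub, hab, sub_self])
  choose s hs using hπ
  refine ⟨{ toFun := fun c => s c * j, map_mul' := ?_, map_zero' := ?_, map_add' := ?_ }, ?_⟩
  · intro x y
    rw [mul_mul_mul_comm, hjj]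
    exact key _ _ (by rw [map_mul, hs, hs, hs])
  · rw [key (s 0) 0 (by rw [hs, map_zero]), zero_mul]
  · intro x y
    rw [← add_mul]
    exact key _ _ (by rw [map_add, hs, hs, hs])
  · intro c
    change π (s c * j) = c
    rw [map_mul, hs, hπj, mul_one]

end Splitting

section Hyperbolic

open NumberField NumberField.Units

variable {A : Type*} [Ring A] [Module ℚ A] {Γ : Subring A} {B : Type*} [CommRing B]
  [IsSemisimpleRing B]

/-- The unit rank of a residue field of a commutative subalgebra is at most one. -/
theorem HasHyperbolicProperty.rank_le_one (hA : HasHyperbolicProperty A) (hΓ : IsZOrder Γ)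
    (φ : B →ₙ+* A) (hφ : Function.Injective φ) {K : Type*} [Field K] [NumberField K]
    (π : B →+* K) (hπ : Function.Surjective π) : rank K ≤ 1 := by
  by_contra! h
  obtain ⟨f, hf⟩ := exists_injective_units_of_two_le_rank K h
  obtain ⟨σ, hσ⟩ := exists_nonUnitalRingHom_section π hπ
  refine hA Γ hΓ (hΓ.exists_injective_units
    ((φ.comp σ).comp ((algebraMap (𝓞 K) K : 𝓞 K →+* K) : 𝓞 K →ₙ+* K)) ?_ f hf)
  exact (hφ.comp (Function.LeftInverse.injective hσ)).comp (RingOfIntegers.coe_injective)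

/-- At most one residue field of a commutative subalgebra has positive unit rank. -/
theorem HasHyperbolicProperty.rank_eq_zero_or (hA : HasHyperbolicProperty A) (hΓ : IsZOrder Γ)
    (φ : B →ₙ+* A) (hφ : Function.Injective φ) {K L : Type*} [Field K] [NumberField K]
    [Field L] [NumberField L] (π : B →+* K) (hπ : Function.Surjective π)
    (ρ : B →+* L) (hρ : Function.Surjective ρ) (hne : RingHom.ker π ≠ RingHom.ker ρ) :
    rank K = 0 ∨ rank L = 0 := by
  by_contra! h
  obtain ⟨a, ha⟩ := exists_unit_zpow_eq_one_imp_of_one_le_rank K (by omega)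
  obtain ⟨b, hb⟩ := exists_unit_zpow_eq_one_imp_of_one_le_rank L (by omega)
  have hsurj : Function.Surjective (π.prod ρ) := by
    have m1 := RingHom.ker_isMaximal_of_surjective π hπ
    have m2 := RingHom.ker_isMaximal_of_surjective ρ hρ
    obtain ⟨x, hx, y, hy, hxy⟩ := Submodule.mem_sup.1
      (show (1 : B) ∈ RingHom.ker π ⊔ RingHom.ker ρ by rw [m1.coprime_of_ne m2 hne]; trivial)
    rw [RingHom.mem_ker] at hx hy
    have hy1 : π y = 1 := by rw [← map_one π, ← hxy, map_add, hx, zero_add]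
    have hx1 : ρ x = 1 := by rw [← map_one ρ, ← hxy, map_add, hy, add_zero]
    rintro ⟨k, l⟩
    obtain ⟨c, rfl⟩ := hπ k
    obtain ⟨d, rfl⟩ := hρ l
    exact ⟨c * y + d * x, by simp [hx, hy, hx1, hy1]⟩
  obtain ⟨σ, hσ⟩ := exists_nonUnitalRingHom_section _ hsurj
  let j : 𝓞 K × 𝓞 L →+* K × L := (algebraMap (𝓞 K) K).prodMap (algebraMap (𝓞 L) L)
  have hj : Function.Injective j :=
    Function.Injective.prodMap RingOfIntegers.coe_injective RingOfIntegers.coe_injective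
  let f : Multiplicative (ℤ × ℤ) →* (𝓞 K × 𝓞 L)ˣ :=
    { toFun := fun v => MulEquiv.prodUnits.symm (a ^ v.toAdd.1, b ^ v.toAdd.2)
      map_one' := by simp
      map_mul' := fun v w => by
        rw [← map_mul, Prod.mk_mul_mk, ← zpow_add, ← zpow_add]; rfl }
  have hf : Function.Injective f := by
    refine (injective_iff_map_eq_one _).2 fun v hv => ?_
    have h1 : ((a ^ v.toAdd.1, b ^ v.toAdd.2) : (𝓞 K)ˣ × (𝓞 L)ˣ) = 1 :=
      MulEquiv.prodUnits.symm.injective (hv.trans (map_one _).symm)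
    rw [Prod.mk_eq_one] at h1
    exact Multiplicative.toAdd.injective (Prod.ext (ha _ h1.1) (hb _ h1.2))
  refine hA Γ hΓ (hΓ.exists_injective_units ((φ.comp σ).comp (j : _ →ₙ+* K × L)) ?_ f hf)
  exact (hφ.comp (Function.LeftInverse.injective hσ)).comp hj

end Hyperbolic

section Definite

open Polynomial

/-- An element of a `ℚ`-algebra is definite if it is rational or a zero of a quadratic polynomial
over `ℚ` with negative discriminant. -/
def IsDefinite {D : Type*} [Ring D] [Algebra ℚ D] (y : D) : Prop :=
  (∃ r : ℚ, y = algebraMap ℚ D r) ∨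
    ∃ t n : ℚ, t ^ 2 < 4 * n ∧ y * y - t • y + algebraMap ℚ D n = 0

variable {D : Type*} [Ring D] [Algebra ℚ D] [Nontrivial D]

theorem IsDefinite.eq_zero_of_mul_self {y : D} (h : IsDefinite y) (hy : y * y = 0) : y = 0 := by
  rcases h with ⟨r, rfl⟩ | ⟨t, n, htn, h⟩
  · rw [← map_mul, map_eq_zero_iff _ (algebraMap ℚ D).injective, mul_self_eq_zero] at hy
    rw [hy, map_zero]
  · have h1 : y * (y * y - t • y + algebraMap ℚ D n) = n • y := by
      rw [mul_add, mul_sub, hy, mul_smul_comm, hy, ← Algebra.commutes, ← Algebra.smul_def]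
      simp
    rw [h, mul_zero] at h1
    exact (smul_eq_zero.1 h1.symm).resolve_left (by nlinarith [sq_nonneg t])

theorem IsIntegral.exists_int_of_definite {y : D} (hy : IsIntegral ℤ y) {t n : ℚ}
    (htn : t ^ 2 < 4 * n) (h : y * y - t • y + algebraMap ℚ D n = 0) :
    ∃ a b : ℤ, t = a ∧ n = b := by
  obtain ⟨p, hp, hpy⟩ := hy
  let q : ℚ[X] := X ^ 2 - C t * X + C n
  have hq : q = C 1 * X ^ 2 + C (-t) * X + C n := by simp [q]; ring
  have hqd : q.natDegree = 2 := by rw [hq]; exact natDegree_quadratic one_ne_zero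
  have hqm : q.Monic := by rw [Monic, hq]; exact leadingCoeff_quadratic one_ne_zero
  have hirr : Irreducible q := by
    refine irreducible_of_degree_le_three_of_not_isRoot (by rw [hqd]; decide) fun x hx => ?_
    have : x ^ 2 - t * x + n = 0 := by simpa [q, IsRoot.def] using hx
    nlinarith [sq_nonneg (2 * x - t)]
  have hqy : aeval y q = 0 := by
    simp only [q, map_add, map_sub, map_mul, map_pow, aeval_X, aeval_C]
    rw [← Algebra.smul_def, sq, h]
  have hpy' : aeval y (p.map (algebraMap ℤ ℚ)) = 0 := by
    rw [aeval_map_algebraMap]; exact hpy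
  have hdvd : q ∣ p.map (algebraMap ℤ ℚ) := by
    by_contra hnd
    obtain ⟨a, b, hab⟩ := (hirr.coprime_iff_not_dvd).2 hnd
    have := congrArg (aeval y) hab
    rw [map_add, map_mul, map_mul, hqy, hpy', mul_zero, mul_zero, add_zero, map_one] at this
    exact zero_ne_one this
  obtain ⟨g, hg⟩ := IsIntegrallyClosed.eq_map_mul_C_of_dvd ℚ hp hdvd
  rw [hqm.leadingCoeff, C_1, mul_one] at hg
  refine ⟨-g.coeff 1, g.coeff 0, ?_, ?_⟩
  · have := congrArg (fun r => coeff r 1) hg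
    rw [hq] at this
    simp [coeff_C] at this
    push_cast; linarith
  · have := congrArg (fun r => coeff r 0) hg
    rw [hq] at this
    simp at this
    linarith

theorem exists_int_of_isIntegral_algebraMap {r : ℚ} (h : IsIntegral ℤ (algebraMap ℚ D r)) :
    ∃ a : ℤ, r = a := by
  have h1 : IsIntegral ℤ r :=
    (isIntegral_algHom_iff (IsScalarTower.toAlgHom ℤ ℚ D) (algebraMap ℚ D).injective).1 h
  obtain ⟨a, ha⟩ := IsIntegrallyClosed.isIntegral_iff.1 h1
  exact ⟨a, ha.symm⟩

/-- A definite element which is integral together with its inverse is a root of unity. -/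
theorem IsDefinite.pow_twelve_eq_one {y z : D} (h : IsDefinite y) (hyz : y * z = 1)
    (hzy : z * y = 1) (hy : IsIntegral ℤ y) (hz : IsIntegral ℤ z) : y ^ 12 = 1 := by
  rcases h with ⟨r, rfl⟩ | ⟨t, n, htn, h⟩
  · have hr : r ≠ 0 := by
      rintro rfl
      rw [map_zero, zero_mul] at hyz
      exact zero_ne_one hyz
    have hz' : z = algebraMap ℚ D r⁻¹ := by
      calc z = algebraMap ℚ D r⁻¹ * (algebraMap ℚ D r * z) := by
            rw [← mul_assoc, ← map_mul, inv_mul_cancel₀ hr, map_one, one_mul]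
        _ = _ := by rw [hyz, mul_one]
    obtain ⟨a, rfl⟩ := exists_int_of_isIntegral_algebraMap hy
    rw [hz'] at hz
    obtain ⟨b, hb⟩ := exists_int_of_isIntegral_algebraMap hz
    have hab : a * b = 1 := by
      have : (a : ℚ) * b = 1 := by rw [← hb, mul_inv_cancel₀ hr]
      exact_mod_cast this
    rw [← map_pow]
    rcases Int.eq_one_or_neg_one_of_mul_eq_one hab with rfl | rfl <;> norm_num
  · have hn : 0 < n := by nlinarith [sq_nonneg t]
    obtain ⟨a, b, rfl, rfl⟩ := hy.exists_int_of_definite htn h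
    have hz2 : z * z - ((a : ℚ) / b) • z + algebraMap ℚ D (1 / b) = 0 := by
      have h1 : z * (y * y - (a : ℚ) • y + algebraMap ℚ D b) * z
          = 1 - (a : ℚ) • z + (b : ℚ) • (z * z) := by
        rw [mul_add, mul_sub, add_mul, sub_mul, mul_smul_comm, hzy, ← mul_assoc z, hzy, one_mul,
          hyz, smul_mul_assoc, one_mul, ← Algebra.commutes, mul_assoc, ← Algebra.smul_def]
      rw [h, mul_zero, zero_mul] at h1
      have h2 := congrArg (fun w => (1 / (b : ℚ)) • w) h1
      simp only [smul_zero, smul_add, smul_sub, smul_smul] at h2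
      rw [one_div_mul_cancel hn.ne', one_smul] at h2
      rw [Algebra.algebraMap_eq_smul_one, h2, div_eq_mul_inv, one_div, mul_comm]
      abel
    have htn2 : ((a : ℚ) / b) ^ 2 < 4 * (1 / b) := by
      rw [div_pow, div_lt_iff₀ (by positivity)]
      calc (a : ℚ) ^ 2 < 4 * b := htn
        _ = 4 * (1 / b) * b ^ 2 := by field_simp
    obtain ⟨-, c, -, hc⟩ := hz.exists_int_of_definite htn2 hz2
    have hbc : b * c = 1 := by
      have : (b : ℚ) * c = 1 := by rw [← hc, mul_one_div_cancel hn.ne']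
      exact_mod_cast this
    have hb : b = 1 := by
      rcases Int.eq_one_or_neg_one_of_mul_eq_one hbc with rfl | rfl
      · rfl
      · norm_num at hn
    subst hb
    have ha : a ^ 2 < 4 := by exact_mod_cast htn
    have ha1 : -2 < a := by nlinarith
    have ha2 : a < 2 := by nlinarith
    have hyy : y * y = (a : ℚ) • y - 1 := by
      have := h
      rw [Int.cast_one, map_one] at this
      rw [← sub_eq_zero, ← this]; abel
    have h12 : y ^ 12 = (y * y * y) ^ 4 := by noncomm_ring
    have h12' : y ^ 12 = (y * y) ^ 6 := by noncomm_ring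
    interval_cases a
    · have h3 : y * y * y = 1 := by
        rw [hyy]; push_cast; rw [sub_mul, smul_mul_assoc, hyy]; push_cast; simp
      rw [h12, h3, one_pow]
    · rw [h12', hyy]; norm_num
    · have h3 : y * y * y = -1 := by
        rw [hyy]; push_cast; rw [sub_mul, smul_mul_assoc, hyy]; push_cast; simp
      rw [h12, h3]; norm_num

end Definite

section TorsionUnits

/-- The units which are integral together with their inverses have order dividing `12`. -/
def HasTorsionIntegralUnits (A : Type*) [Ring A] : Prop :=
  ∀ u v : A, u * v = 1 → v * u = 1 → IsIntegral ℤ u → IsIntegral ℤ v → u ^ 12 = 1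

theorem map_pow_twelve_eq_one {A D : Type*} [Ring A] [Algebra ℚ A] [Ring D] [Algebra ℚ D]
    [Nontrivial D] (φ : A →ₐ[ℚ] D) (hφ : ∀ x, IsDefinite (φ x)) {x y : A} (hxy : x * y = 1)
    (hyx : y * x = 1) (hx : IsIntegral ℤ x) (hy : IsIntegral ℤ y) : φ (x ^ 12) = 1 := by
  rw [map_pow]
  exact (hφ x).pow_twelve_eq_one (z := φ y) (by rw [← map_mul, hxy, map_one])
    (by rw [← map_mul, hyx, map_one])
    (hx.map (φ.restrictScalars ℤ)) (hy.map (φ.restrictScalars ℤ))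

theorem map_eq_zero_of_mul_self {A D : Type*} [Ring A] [Algebra ℚ A] [Ring D] [Algebra ℚ D]
    [Nontrivial D] (φ : A →ₐ[ℚ] D) (hφ : ∀ x, IsDefinite (φ x)) {x : A} (hx : x * x = 0) :
    φ x = 0 :=
  (hφ x).eq_zero_of_mul_self (by rw [← map_mul, hx, map_zero])

theorem isReduced_of_mul_self {A : Type*} [Ring A] (h : ∀ x : A, x * x = 0 → x = 0) :
    IsReduced A :=
  (isReduced_iff_pow_one_lt 2 one_lt_two).2 fun x hx => h x (by rwa [← sq])

end TorsionUnits

section Characters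

open MonoidAlgebra

variable {G : Type u} [Group G]

/-- If the values of a complex character lie in an imaginary quadratic field, then the image of
the rational group algebra consists of definite elements. -/
theorem isDefinite_lift_of_quadratic (χ : G →* ℂ) {θ : ℂ} {p q : ℚ} (hpq : p ^ 2 + 4 * q < 0)
    (hθ : θ * θ = p * θ + q) (hχ : ∀ g, ∃ a b : ℚ, χ g = a + b * θ) (x : MonoidAlgebra ℚ G) :
    IsDefinite (lift ℚ ℂ G χ x) := by
  have hx : ∃ a b : ℚ, lift ℚ ℂ G χ x = a + b * θ := by
    induction x using MonoidAlgebra.induction_linear with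
    | zero => exact ⟨0, 0, by simp⟩
    | add x y hx hy =>
      obtain ⟨a, b, h1⟩ := hx
      obtain ⟨c, d, h2⟩ := hy
      exact ⟨a + c, b + d, by rw [map_add, h1, h2]; push_cast; ring⟩
    | single g r =>
      obtain ⟨a, b, h⟩ := hχ g
      refine ⟨r * a, r * b, ?_⟩
      rw [lift_single, h, Algebra.smul_def, eq_ratCast]
      push_cast; ring
  obtain ⟨a, b, h⟩ := hx
  rw [h]
  by_cases hb : b = 0
  · exact .inl ⟨a, by simp [hb]⟩
  · refine .inr ⟨2 * a + p * b, a ^ 2 + p * a * b - q * b ^ 2, ?_, ?_⟩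
    · have : 0 < b ^ 2 := by positivity
      nlinarith
    · rw [Algebra.smul_def, eq_ratCast, eq_ratCast]
      push_cast
      linear_combination (b : ℂ) ^ 2 * hθ

theorem isDefinite_lift_of_pow_four (χ : G →* ℂ) (hχ : ∀ g, χ g ^ 4 = 1)
    (x : MonoidAlgebra ℚ G) : IsDefinite (lift ℚ ℂ G χ x) := by
  refine isDefinite_lift_of_quadratic χ (θ := Complex.I) (p := 0) (q := -1) (by norm_num)
    (by simp) (fun g => ?_) x
  have h := hχ g
  have h1 : (χ g - 1) * ((χ g + 1) * ((χ g - Complex.I) * (χ g + Complex.I))) = 0 := by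
    linear_combination h - (χ g ^ 2 - 1) * Complex.I_mul_I
  rcases mul_eq_zero.1 h1 with h2 | h1
  · exact ⟨1, 0, by push_cast; linear_combination h2⟩
  rcases mul_eq_zero.1 h1 with h2 | h1
  · exact ⟨-1, 0, by push_cast; linear_combination h2⟩
  rcases mul_eq_zero.1 h1 with h2 | h2
  · exact ⟨0, 1, by push_cast; linear_combination h2⟩
  · exact ⟨0, -1, by push_cast; linear_combination h2⟩

theorem isDefinite_lift_of_pow_six (χ : G →* ℂ) (hχ : ∀ g, χ g ^ 6 = 1)
    (x : MonoidAlgebra ℚ G) : IsDefinite (lift ℚ ℂ G χ x) := by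
  obtain ⟨ω, hω⟩ : ∃ ω : ℂ, 1 * (ω * ω) + 1 * ω + 1 = 0 :=
    exists_quadratic_eq_zero one_ne_zero ((IsAlgClosed.exists_pow_nat_eq (discrim 1 1 1) two_pos).imp
      fun s hs => by rw [← hs, sq])
  refine isDefinite_lift_of_quadratic χ (θ := ω) (p := -1) (q := -1) (by norm_num)
    (by push_cast; linear_combination hω) (fun g => ?_) x
  have h := hχ g
  set y := χ g
  have h1 : (y - 1) * ((y + 1) * ((y - ω) * ((y + 1 + ω) * ((y + ω) * (y - 1 - ω))))) = 0 := by
    have e1 : (y - ω) * (y + 1 + ω) = y ^ 2 + y + 1 := by linear_combination -hω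
    have e2 : (y + ω) * (y - 1 - ω) = y ^ 2 - y + 1 := by linear_combination -hω
    calc _ = (y - 1) * (y + 1) * ((y - ω) * (y + 1 + ω)) * ((y + ω) * (y - 1 - ω)) := by ring
      _ = 0 := by rw [e1, e2]; linear_combination h
  rcases mul_eq_zero.1 h1 with h2 | h1
  · exact ⟨1, 0, by push_cast; linear_combination h2⟩
  rcases mul_eq_zero.1 h1 with h2 | h1
  · exact ⟨-1, 0, by push_cast; linear_combination h2⟩
  rcases mul_eq_zero.1 h1 with h2 | h1
  · exact ⟨0, 1, by push_cast; linear_combination h2⟩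
  rcases mul_eq_zero.1 h1 with h2 | h1
  · exact ⟨-1, -1, by push_cast; linear_combination h2⟩
  rcases mul_eq_zero.1 h1 with h2 | h2
  · exact ⟨0, -1, by push_cast; linear_combination h2⟩
  · exact ⟨1, 1, by push_cast; linear_combination h2⟩

/-- A function on a finite abelian group which is orthogonal to all characters vanishes. -/
theorem eq_zero_of_forall_sum_char_eq_zero {G : Type*} [CommGroup G] [Fintype G] (f : G → ℂ)
    (h : ∀ χ : G →* ℂ, ∑ g, f g * χ g = 0) : f = 0 := by
  classical
  let F : (Additive G → ℂ) →ₗ[ℂ] ℂ :=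
    { toFun := fun k => ∑ g : G, f g * k (Additive.ofMul g)
      map_add' := fun k l => by simp [mul_add, Finset.sum_add_distrib]
      map_smul' := fun c k => by
        simp only [Pi.smul_apply, smul_eq_mul, RingHom.id_apply, Finset.mul_sum]
        exact Finset.sum_congr rfl fun g _ => by ring }
  have hF : F = 0 := by
    refine (AddChar.complexBasis (Additive G)).ext fun ψ => ?_
    rw [AddChar.complexBasis_apply]
    exact h (AddChar.toMonoidHom ψ)
  funext g
  have := LinearMap.congr_fun hF (Pi.single (Additive.ofMul g) 1)
  have h2 : F (Pi.single (Additive.ofMul g) 1) = f g := by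
    change ∑ k : G, f k * (Pi.single (Additive.ofMul g) (1 : ℂ) : Additive G → ℂ) (Additive.ofMul k) = _
    rw [Finset.sum_eq_single g]
    · simp
    · intro k _ hk
      rw [Pi.single_eq_of_ne (by simpa using hk), mul_zero]
    · simp
  rw [← h2, this]
  rfl

theorem lift_complex_apply [Fintype G] (χ : G →* ℂ) (x : MonoidAlgebra ℚ G) :
    lift ℚ ℂ G χ x = ∑ g, (x.coeff g : ℂ) * χ g := by
  rw [lift_apply, Finsupp.sum_fintype _ _ (by simp)]
  exact Finset.sum_congr rfl fun g _ => by rw [Algebra.smul_def, eq_ratCast]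

theorem eq_zero_of_forall_lift_eq_zero {G : Type u} [CommGroup G] [Finite G]
    (x : MonoidAlgebra ℚ G) (h : ∀ χ : G →* ℂ, lift ℚ ℂ G χ x = 0) : x = 0 := by
  have := Fintype.ofFinite G
  have h1 := eq_zero_of_forall_sum_char_eq_zero (fun g => (x.coeff g : ℂ)) fun χ => by
    rw [← lift_complex_apply, h]
  ext g
  simpa using congrFun h1 g

/-- The group algebra of an abelian group of exponent dividing `4` or `6`. -/
theorem isReduced_and_hasTorsionIntegralUnits_of_exponent {G : Type u} [CommGroup G] [Finite G]
    (hG : Monoid.exponent G ∣ 4 ∨ Monoid.exponent G ∣ 6) :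
    IsReduced (MonoidAlgebra ℚ G) ∧ HasTorsionIntegralUnits (MonoidAlgebra ℚ G) := by
  have key : ∀ (χ : G →* ℂ) x, IsDefinite (lift ℚ ℂ G χ x) := by
    intro χ x
    rcases hG with h | h
    · exact isDefinite_lift_of_pow_four χ (fun g => by
        rw [← map_pow, Monoid.exponent_dvd_iff_forall_pow_eq_one.1 h, map_one]) x
    · exact isDefinite_lift_of_pow_six χ (fun g => by
        rw [← map_pow, Monoid.exponent_dvd_iff_forall_pow_eq_one.1 h, map_one]) x
  refine ⟨isReduced_of_mul_self fun x hx => ?_, fun u v huv hvu hu hv => ?_⟩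
  · exact eq_zero_of_forall_lift_eq_zero x fun χ => map_eq_zero_of_mul_self _ (key χ) hx
  · rw [← sub_eq_zero]
    refine eq_zero_of_forall_lift_eq_zero _ fun χ => ?_
    rw [map_sub, map_pow_twelve_eq_one _ (key χ) huv hvu hu hv, map_one, sub_self]

/-- The group algebra of a cyclic group of order `5`, `8` or `12`. -/
theorem isReduced_and_exists_algHom_of_cyclic {G : Type u} [CommGroup G] [Finite G] {n : ℕ}
    [NeZero n] (hn : n = 5 ∨ n = 8 ∨ n = 12) {g : G} (hg : ∀ x, x ∈ Subgroup.zpowers g)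
    (hgn : orderOf g = n) (K : Type*) [Field K] [NumberField K] [IsCyclotomicExtension {n} ℚ K] :
    IsReduced (MonoidAlgebra ℚ G) ∧ ∃ Φ : MonoidAlgebra ℚ G →ₐ[ℚ] K,
      ∀ u v, u * v = 1 → v * u = 1 → IsIntegral ℤ u → IsIntegral ℤ v → Φ u = 1 → u ^ 12 = 1 := by
  let ζ := IsCyclotomicExtension.zeta n ℚ K
  have hζ : IsPrimitiveRoot ζ n := IsCyclotomicExtension.zeta_spec n ℚ K
  obtain ⟨ζ', hζ'⟩ := hζ.isUnit (NeZero.ne n)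
  have hζ'n : IsPrimitiveRoot ζ' n := IsPrimitiveRoot.coe_units_iff.1 (hζ' ▸ hζ)
  let ρ' : G →* Kˣ := monoidHomOfForallMemZpowers hg (g' := ζ') (by rw [← hζ'n.eq_orderOf, hgn])
  let ρ : G →* K := (Units.coeHom K).comp ρ'
  have hρ : ρ g = ζ := by
    change ((ρ' g : Kˣ) : K) = ζ
    rw [monoidHomOfForallMemZpowers_apply_gen, hζ']
  let Φ := lift ℚ K G ρ
  have key : ∀ χ : G →* ℂ, (∀ x, IsDefinite (lift ℚ ℂ G χ x)) ∨
      ∀ x, Φ x = 0 → lift ℚ ℂ G χ x = 0 := by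
    intro χ
    have hz : χ g ^ n = 1 := by rw [← map_pow, ← hgn, pow_orderOf_eq_one, map_one]
    by_cases hprim : IsPrimitiveRoot (χ g) n
    · right
      have hirr := Polynomial.cyclotomic.irreducible_rat (NeZero.pos n)
      let τ : K →ₐ[ℚ] ℂ := (hζ.embeddingsEquivPrimitiveRoots ℂ hirr).symm
        ⟨χ g, (mem_primitiveRoots (NeZero.pos n)).2 hprim⟩
      have hτ : τ ζ = χ g := by
        rw [← hζ.embeddingsEquivPrimitiveRoots_apply_coe ℂ hirr, Equiv.apply_symm_apply]
      have hχ : χ = (τ : K →* ℂ).comp ρ := by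
        ext x
        obtain ⟨k, rfl⟩ := (mem_powers_iff_mem_zpowers).2 (hg x)
        simp [hρ, hτ]
      have hcomp : lift ℚ ℂ G χ = τ.comp Φ := by
        apply MonoidAlgebra.algHom_ext
        · intro x
          simp [Φ, hχ]
        · exact Subsingleton.elim _ _
      intro x hx
      rw [hcomp, AlgHom.comp_apply, hx, map_zero]
    · left
      have h46 : χ g ^ 4 = 1 ∨ χ g ^ 6 = 1 := by
        have hd : orderOf (χ g) ∣ n := orderOf_dvd_of_pow_eq_one hz
        have hne : orderOf (χ g) ≠ n := fun h => hprim (h ▸ IsPrimitiveRoot.orderOf _)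
        simp only [← orderOf_dvd_iff_pow_eq_one]
        have hle := Nat.le_of_dvd (NeZero.pos n) hd
        generalize orderOf (χ g) = d at *
        rcases hn with rfl | rfl | rfl <;> interval_cases d <;> omega
      rcases h46 with h | h
      · refine isDefinite_lift_of_pow_four χ fun x => ?_
        obtain ⟨k, rfl⟩ := (mem_powers_iff_mem_zpowers).2 (hg x)
        simp only [map_pow]
        rw [pow_right_comm, h, one_pow]
      · refine isDefinite_lift_of_pow_six χ fun x => ?_
        obtain ⟨k, rfl⟩ := (mem_powers_iff_mem_zpowers).2 (hg x)
        simp only [map_pow]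
        rw [pow_right_comm, h, one_pow]
  refine ⟨isReduced_of_mul_self fun x hx => ?_, Φ, fun u v huv hvu hu hv h => ?_⟩
  · refine eq_zero_of_forall_lift_eq_zero x fun χ => ?_
    rcases key χ with h | h
    · exact map_eq_zero_of_mul_self _ h hx
    · refine h x ?_
      have : Φ x * Φ x = 0 := by rw [← map_mul, hx, map_zero]
      exact mul_self_eq_zero.1 this
  · rw [← sub_eq_zero]
    refine eq_zero_of_forall_lift_eq_zero _ fun χ => ?_
    rcases key χ with h1 | h1
    · rw [map_sub, map_pow_twelve_eq_one _ h1 huv hvu hu hv, map_one, sub_self]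
    · exact h1 _ (by rw [map_sub, map_pow, h, one_pow, map_one, sub_self])

end Characters

section DedekindGroups

variable {G : Type u} [Group G]

theorem conj_mem_zpowers (hn : ∀ H : Subgroup G, H.Normal) (a g : G) :
    g * a * g⁻¹ ∈ Subgroup.zpowers a :=
  (hn (Subgroup.zpowers a)).conj_mem a (Subgroup.mem_zpowers a) g

theorem commutator_mem_zpowers_left (hn : ∀ H : Subgroup G, H.Normal) (a b : G) :
    a * b * a⁻¹ * b⁻¹ ∈ Subgroup.zpowers a := by
  have h := conj_mem_zpowers hn a⁻¹ b
  rw [Subgroup.zpowers_inv] at h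
  have := Subgroup.mul_mem _ (Subgroup.mem_zpowers a) h
  simpa [mul_assoc] using this

theorem commutator_mem_zpowers_right (hn : ∀ H : Subgroup G, H.Normal) (a b : G) :
    a * b * a⁻¹ * b⁻¹ ∈ Subgroup.zpowers b :=
  Subgroup.mul_mem _ (conj_mem_zpowers hn b a) (Subgroup.inv_mem _ (Subgroup.mem_zpowers b))

theorem commute_of_mem_zpowers {a c : G} (h : c ∈ Subgroup.zpowers a) : Commute c a := by
  obtain ⟨k, rfl⟩ := h
  exact (Commute.refl a).zpow_left k

/-- The involution in a cyclic `2`-group. -/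
theorem eq_pow_of_mem_zpowers_of_sq_eq_one {a c : G} {m : ℕ} (ha : orderOf a = 2 ^ (m + 1))
    (hc : c ∈ Subgroup.zpowers a) (hc1 : c ≠ 1) (hc2 : c * c = 1) : c = a ^ 2 ^ m := by
  obtain ⟨k, rfl⟩ := hc
  simp only at hc1 hc2 ⊢
  rw [← zpow_add, ← orderOf_dvd_iff_zpow_eq_one, ha] at hc2
  obtain ⟨l, hl⟩ := hc2
  have hk : k = 2 ^ m * l := by
    have : k + k = 2 * (2 ^ m * l) := by rw [hl]; push_cast; ring
    omega
  subst hk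
  have hs : a ^ ((2 : ℤ) ^ m * 2) = 1 := by
    rw [← orderOf_dvd_iff_zpow_eq_one, ha, ← pow_succ]; push_cast; rfl
  rcases Int.even_or_odd' l with ⟨r, rfl | rfl⟩
  · exact absurd (by rw [← mul_assoc, zpow_mul, hs, one_zpow]) hc1
  · rw [mul_add, ← mul_assoc, mul_one, zpow_add, zpow_mul, hs, one_zpow, one_mul]
    exact_mod_cast zpow_natCast a (2 ^ m)

/-- The quaternion relations, together with the fact that the group is generated by `a`, `b` and
central involutions. -/
structure IsQuaternionDecomposition (a b c : G) : Prop where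
  ne_one : c ≠ 1
  sq_eq_one : c * c = 1
  sq_left : a * a = c
  sq_right : b * b = c
  mul_eq : a * b = c * (b * a)
  comm : ∀ g : G, c * g = g * c
  comm_of_sq : ∀ h : G, h * h = 1 → ∀ g : G, h * g = g * h
  exists_eq : ∀ g : G, ∃ h : G, h * h = 1 ∧ (g = h ∨ g = h * a ∨ g = h * b ∨ g = h * (a * b))

theorem exists_quaternion_pair [Finite G] (h2 : IsPGroup 2 G) (hnc : ¬ ∀ a b : G, a * b = b * a)
    (hn : ∀ H : Subgroup G, H.Normal) :
    ∃ a b c : G, c ≠ 1 ∧ c * c = 1 ∧ a * a = c ∧ b * b = c ∧ a * b = c * (b * a) := by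
  push Not at hnc
  obtain ⟨a₀, b₀, hab₀⟩ := hnc
  let s : Set (G × G) := {p | p.1 * p.2 ≠ p.2 * p.1}
  obtain ⟨⟨a, b⟩, hab, hmin⟩ := (measure fun p : G × G => orderOf p.1 + orderOf p.2).wf.has_min s
    ⟨(a₀, b₀), hab₀⟩
  replace hmin : ∀ x y : G, orderOf x + orderOf y < orderOf a + orderOf b → x * y = y * x := by
    intro x y hlt
    by_contra h
    exact hmin (x, y) h hlt
  replace hab : a * b ≠ b * a := hab
  clear hab₀ a₀ b₀ s
  have hne : ∀ x y : G, x * y ≠ y * x → x ≠ 1 := by rintro x y h rfl; simp at h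
  have hlt : ∀ x : G, x ≠ 1 → orderOf (x ^ 2) < orderOf x := by
    intro x hx
    obtain ⟨m, hm⟩ := IsPGroup.iff_orderOf.1 h2 x
    have hm0 : m ≠ 0 := by
      rintro rfl
      rw [pow_zero, orderOf_eq_one_iff] at hm
      exact hx hm
    rw [orderOf_pow_of_dvd two_ne_zero (hm ▸ dvd_pow_self 2 hm0)]
    exact Nat.div_lt_self (orderOf_pos x) one_lt_two
  -- everything that holds for `(a, b)` also holds for `(b, a)`
  wlog hle : orderOf b ≤ orderOf a generalizing a b
  · obtain ⟨b', a', c, h1, h2, h3, h4, h5⟩ := this b a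
      (fun x y hxy => hmin x y (by omega)) hab.symm (by omega)
    exact ⟨b', a', c, h1, h2, h3, h4, h5⟩
  set c := a * b * a⁻¹ * b⁻¹ with hc
  have hca : Commute c a := commute_of_mem_zpowers (commutator_mem_zpowers_left hn a b)
  have hcb : Commute c b := commute_of_mem_zpowers (commutator_mem_zpowers_right hn a b)
  have hc1 : c ≠ 1 := by
    intro h
    apply hab
    rw [hc, mul_inv_eq_one, mul_inv_eq_iff_eq_mul] at h
    exact h
  have hmul : a * b = c * (b * a) := by rw [hc]; group
  have ha2 : Commute (a ^ 2) b := hmin _ _ (by have := hlt a (hne _ _ hab); omega)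
  have hb2 : Commute (b ^ 2) a := hmin _ _ (by have := hlt b (hne _ _ hab.symm); omega)
  have hcc : c * c = 1 := by
    have h1 : a ^ 2 * b = c * c * (b * a ^ 2) := by
      calc a ^ 2 * b = a * (a * b) := by rw [sq, mul_assoc]
        _ = a * (c * (b * a)) := by rw [hmul]
        _ = c * (a * b) * a := by rw [← mul_assoc a, ← hca.eq]; simp only [mul_assoc]
        _ = c * c * (b * a ^ 2) := by rw [hmul, sq]; simp only [mul_assoc]
    rw [ha2.eq] at h1
    exact (mul_eq_right.1 h1.symm)
  obtain ⟨m, hm⟩ := IsPGroup.iff_orderOf.1 h2 a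
  obtain ⟨k, hk⟩ := IsPGroup.iff_orderOf.1 h2 b
  have hm0 : m ≠ 0 := by
    rintro rfl
    rw [pow_zero, orderOf_eq_one_iff] at hm
    exact hne _ _ hab hm
  have hk0 : k ≠ 0 := by
    rintro rfl
    rw [pow_zero, orderOf_eq_one_iff] at hk
    exact hne _ _ hab.symm hk
  obtain ⟨m, rfl⟩ := Nat.exists_eq_succ_of_ne_zero hm0
  obtain ⟨k, rfl⟩ := Nat.exists_eq_succ_of_ne_zero hk0
  have hcam := eq_pow_of_mem_zpowers_of_sq_eq_one hm (commutator_mem_zpowers_left hn a b) hc1 hcc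
  have hcbk := eq_pow_of_mem_zpowers_of_sq_eq_one hk (commutator_mem_zpowers_right hn a b) hc1 hcc
  rw [← hc] at hcam hcbk
  have hkm : k ≤ m := by
    rw [hm, hk] at hle
    have := (Nat.pow_le_pow_iff_right one_lt_two).1 hle
    omega
  have hk1 : k ≠ 0 := by
    rintro rfl
    rw [pow_zero, pow_one] at hcbk
    rw [hcbk] at hca
    exact hab hca.eq.symm
  -- a product `a ^ i * b` of smaller order contradicts minimality
  have hsmall : ∀ i, (a ^ i * b) ^ 2 ^ k ≠ 1 := by
    intro i hi
    have h1 : orderOf (a ^ i * b) < orderOf b := by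
      rw [hk]
      calc orderOf (a ^ i * b) ≤ 2 ^ k := Nat.le_of_dvd (by positivity) (orderOf_dvd_of_pow_eq_one hi)
        _ < 2 ^ (k + 1) := Nat.pow_lt_pow_right one_lt_two (by omega)
    have h3 := hmin a (a ^ i * b) (by omega)
    apply hab
    apply mul_left_cancel (a := a ^ i)
    rw [← mul_assoc, ← pow_succ, pow_succ', mul_assoc, h3, mul_assoc]
  rcases hkm.lt_or_eq with hlt' | rfl
  · exfalso
    apply hsmall (2 ^ (m - k))
    have hcomm : Commute (a ^ 2 ^ (m - k)) b := by
      obtain ⟨r, hr⟩ := Nat.exists_eq_succ_of_ne_zero (show m - k ≠ 0 by omega)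
      rw [hr, Nat.pow_succ', pow_mul]
      exact ha2.pow_left _
    rw [hcomm.mul_pow, ← pow_mul, ← pow_add, Nat.sub_add_cancel hkm, ← hcam, ← hcbk, hcc]
  · by_cases hk2 : k = 1
    · subst hk2
      refine ⟨a, b, c, hc1, hcc, ?_, ?_, hmul⟩
      · rw [hcam]; simp [sq]
      · rw [hcbk]; simp [sq]
    · exfalso
      apply hsmall 1
      obtain ⟨r, rfl⟩ : ∃ r, k = r + 2 := ⟨k - 2, by omega⟩
      have hba : b * a = c * (a * b) := by rw [hmul, ← mul_assoc, hcc, one_mul]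
      have e2 : (a * b) ^ 2 = c * (a ^ 2 * b ^ 2) := by
        calc (a * b) ^ 2 = a * (b * a) * b := by rw [sq]; simp only [mul_assoc]
          _ = c * (a ^ 2 * b ^ 2) := by
            rw [hba, ← mul_assoc a c, ← hca.eq, sq, sq]; simp only [mul_assoc]
      have hab2 : Commute (a ^ 2) (b ^ 2) := ha2.pow_right 2
      have hc2 : Commute c (a ^ 2 * b ^ 2) := (hca.pow_right 2).mul_right (hcb.pow_right 2)
      have e4 : (a * b) ^ 4 = a ^ 4 * b ^ 4 := by
        rw [show 4 = 2 * 2 from rfl, pow_mul, e2, hc2.mul_pow, hab2.mul_pow, sq c, hcc, one_mul,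
          pow_mul, pow_mul]
      have hab4 : Commute (a ^ 4) (b ^ 4) := by
        rw [show 4 = 2 * 2 from rfl, pow_mul, pow_mul]
        exact (hab2.pow_left 2).pow_right 2
      rw [pow_one, pow_add, mul_comm (2 ^ r), show 2 ^ 2 = 4 from rfl, pow_mul, e4, hab4.mul_pow,
        ← pow_mul, ← pow_mul, show 4 * 2 ^ r = 2 ^ (r + 2) by ring, ← hcam,
        ← hcbk, hcc]

theorem conj_eq_of_sq_eq_one (hn : ∀ H : Subgroup G, H.Normal) {h : G} (hh : h * h = 1) (g : G) :
    h * g = g * h := by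
  obtain ⟨k, hk⟩ := conj_mem_zpowers hn h g
  have hk : h ^ k = g * h * g⁻¹ := hk
  have hs : h ^ (2 : ℤ) = 1 := by rw [zpow_two, hh]
  rcases Int.even_or_odd' k with ⟨r, rfl | rfl⟩
  · rw [zpow_mul, hs, one_zpow] at hk
    have : h = 1 := by
      rw [eq_comm, mul_inv_eq_one] at hk
      simpa using hk
    rw [this, one_mul, mul_one]
  · rw [zpow_add, zpow_mul, hs, one_zpow, one_mul, zpow_one] at hk
    rw [eq_mul_inv_iff_mul_eq] at hk
    exact hk

theorem exists_quaternionDecomposition [Finite G] (h2 : IsPGroup 2 G)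
    (hnc : ¬ ∀ a b : G, a * b = b * a) (hn : ∀ H : Subgroup G, H.Normal) :
    ∃ a b c : G, IsQuaternionDecomposition a b c := by
  obtain ⟨a, b, c, hc1, hcc, haa, hbb, hab⟩ := exists_quaternion_pair h2 hnc hn
  have hcen : ∀ g, c * g = g * c := conj_eq_of_sq_eq_one hn hcc
  have hpow : ∀ x : G, x * x = c → ∀ y ∈ Subgroup.zpowers x, y = 1 ∨ y = x ∨ y = c ∨ y = c * x := by
    rintro x hx _ ⟨k, rfl⟩
    have h4 : x ^ (4 : ℤ) = 1 := by
      rw [show (4 : ℤ) = 2 + 2 from rfl, zpow_add, zpow_two, hx, hcc]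
    change x ^ k = 1 ∨ x ^ k = x ∨ x ^ k = c ∨ x ^ k = c * x
    rw [← Int.emod_add_mul_ediv k 4, zpow_add, zpow_mul, h4, one_zpow, mul_one]
    have h1 := Int.emod_nonneg k (show (4 : ℤ) ≠ 0 by decide)
    have h5 := Int.emod_lt_of_pos k (show (0 : ℤ) < 4 by decide)
    generalize k % 4 = r at *
    interval_cases r
    · simp
    · simp
    · right; right; left; rw [zpow_two, hx]
    · right; right; right
      rw [show (3 : ℤ) = 2 + 1 from rfl, zpow_add, zpow_two, hx, zpow_one]
  have hconj : ∀ x : G, x * x = c → ∀ g, g * x * g⁻¹ = x ∨ g * x * g⁻¹ = c * x := by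
    intro x hx g
    have hsq : (g * x * g⁻¹) * (g * x * g⁻¹) = c := by
      calc (g * x * g⁻¹) * (g * x * g⁻¹) = g * (x * x) * g⁻¹ := by group
        _ = c := by rw [hx, ← hcen, mul_inv_cancel_right]
    rcases hpow x hx _ (conj_mem_zpowers hn x g) with h | h | h | h
    · rw [h, one_mul] at hsq; exact absurd hsq.symm hc1
    · exact .inl h
    · rw [h, hcc] at hsq; exact absurd hsq.symm hc1
    · exact .inr h
  have hcx : ∀ x : G, c * (c * x) = x := fun x => by rw [← mul_assoc, hcc, one_mul]
  have hexp : ∀ h, h * a = a * h → h * b = b * h → h * h = 1 := by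
    intro h hha hhb
    by_contra hne
    obtain ⟨m, hm⟩ := IsPGroup.iff_orderOf.1 h2 h
    have hm2 : 2 ≤ m := by
      by_contra! hlt
      apply hne
      rw [← sq, ← orderOf_dvd_iff_pow_eq_one, hm]
      exact pow_dvd_pow 2 (show m ≤ 1 by omega)
    set k := h ^ 2 ^ (m - 2)
    have hk4 : (k * k) * (k * k) = 1 := by
      have : (k * k) * (k * k) = k ^ 4 := by simp only [pow_succ, pow_zero, one_mul, mul_assoc]
      rw [this, ← pow_mul, show 4 = 2 ^ 2 from rfl, ← pow_add, Nat.sub_add_cancel hm2, ← hm,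
        pow_orderOf_eq_one]
    have hk2 : k * k ≠ 1 := by
      intro h0
      rw [← sq, ← pow_mul, ← pow_succ, ← orderOf_dvd_iff_pow_eq_one, hm,
        Nat.pow_dvd_pow_iff_le_right one_lt_two] at h0
      omega
    have hka : Commute k a := Commute.pow_left hha _
    have hkb : Commute k b := Commute.pow_left hhb _
    set x := b * k
    have hax : a * x = c * x * a := by
      calc a * x = (a * b) * k := (mul_assoc _ _ _).symm
        _ = c * (b * (k * a)) := by rw [hab, hka.eq]; simp only [mul_assoc]
        _ = c * x * a := by simp only [x, mul_assoc]
    have hxx : x * x = c * (k * k) := by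
      calc x * x = b * (k * b) * k := by simp only [x, mul_assoc]
        _ = c * (k * k) := by rw [hkb.eq, ← hbb]; simp only [mul_assoc]
    have hx4 : (x * x) * (x * x) = 1 := by
      rw [hxx, mul_assoc, ← mul_assoc (k * k), ← hcen (k * k), mul_assoc c, hk4, mul_one, hcc]
    obtain ⟨r, hr⟩ := conj_mem_zpowers hn x a
    have hr : x ^ r = a * x * a⁻¹ := hr
    rw [hax, mul_inv_cancel_right] at hr
    have hr1 : x ^ (r - 1) = c := by rw [zpow_sub_one, hr, mul_inv_cancel_right]
    have h4 : x ^ (4 : ℤ) = 1 := by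
      rw [show (4 : ℤ) = 2 + 2 from rfl, zpow_add, zpow_two, hx4]
    have hxc : x ≠ c := by
      intro h0
      rw [h0, hcc, one_mul, ← hcen] at hax
      have : c = 1 := by simpa using hax
      exact hc1 this
    rw [← Int.emod_add_mul_ediv (r - 1) 4, zpow_add, zpow_mul, h4, one_zpow, mul_one] at hr1
    have h1 := Int.emod_nonneg (r - 1) (show (4 : ℤ) ≠ 0 by decide)
    have h5 := Int.emod_lt_of_pos (r - 1) (show (0 : ℤ) < 4 by decide)
    generalize (r - 1) % 4 = r at *
    interval_cases r
    · exact hc1 (by simpa using hr1.symm)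
    · exact hxc (by simpa using hr1)
    · rw [zpow_two, hxx, mul_eq_left] at hr1
      exact hk2 hr1
    · apply hxc
      have h3 : x ^ (3 : ℤ) * x = 1 := by rw [← h4]; group
      rw [hr1] at h3
      rw [← hcx x, h3, mul_one]
  refine ⟨a, b, c, hc1, hcc, haa, hbb, hab, hcen, fun h hh => conj_eq_of_sq_eq_one hn hh, ?_⟩
  -- multiply by `b` to centralize `a`, then by `a` to centralize `b`
  have hba : b * a = c * (a * b) := by rw [hab, hcx]
  have hstep : ∀ g, ∃ q, (q = 1 ∨ q = b) ∧ (g * q) * a = a * (g * q) := by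
    intro g
    rcases hconj a haa g with h | h
    · exact ⟨1, .inl rfl, by rw [mul_one]; rwa [mul_inv_eq_iff_eq_mul] at h⟩
    · refine ⟨b, .inr rfl, ?_⟩
      rw [mul_inv_eq_iff_eq_mul] at h
      calc g * b * a = c * (g * a) * b := by
            rw [mul_assoc, hba, ← mul_assoc, ← hcen]; simp only [mul_assoc]
        _ = a * (g * b) := by rw [h]; simp only [mul_assoc, hcx]
  have hstep2 : ∀ g, g * a = a * g → ∃ q, (q = 1 ∨ q = a) ∧ (g * q) * a = a * (g * q) ∧
      (g * q) * b = b * (g * q) := by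
    intro g hga
    rcases hconj b hbb g with h | h
    · exact ⟨1, .inl rfl, by rwa [mul_one], by rw [mul_one]; rwa [mul_inv_eq_iff_eq_mul] at h⟩
    · refine ⟨a, .inr rfl, by rw [hga, mul_assoc, hga], ?_⟩
      rw [mul_inv_eq_iff_eq_mul] at h
      calc g * a * b = c * (g * b) * a := by
            rw [mul_assoc, hab, ← mul_assoc, ← hcen]; simp only [mul_assoc]
        _ = b * (g * a) := by rw [h]; simp only [mul_assoc, hcx]
  have ha' : a⁻¹ = c * a := by rw [inv_eq_iff_mul_eq_one, hcen, ← mul_assoc, haa, hcc]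
  have hb' : b⁻¹ = c * b := by rw [inv_eq_iff_mul_eq_one, hcen, ← mul_assoc, hbb, hcc]
  intro g
  obtain ⟨q, hq, hqa⟩ := hstep g
  obtain ⟨p, hp, hpa, hpb⟩ := hstep2 _ hqa
  have hk := hexp _ hpa hpb
  set k := g * q * p
  have hg : g = k * p⁻¹ * q⁻¹ := by simp only [k]; group
  have hck : c * k * (c * k) = 1 := by
    rw [mul_assoc, ← mul_assoc k, ← hcen k, mul_assoc c, hk, mul_one, hcc]
  rcases hp with hp | hp <;> rcases hq with hq | hq <;> rw [hp, hq] at hg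
  · exact ⟨k, hk, .inl (by simpa using hg)⟩
  · exact ⟨c * k, hck, .inr (.inr (.inl (by rw [hg, hb', hcen k]; simp [mul_assoc])))⟩
  · exact ⟨c * k, hck, .inr (.inl (by rw [hg, ha', hcen k]; simp [mul_assoc]))⟩
  · refine ⟨k, hk, .inr (.inr (.inr ?_))⟩
    have hcab : c * a * (c * b) = a * b := by
      rw [mul_assoc, ← mul_assoc a, ← hcen a, mul_assoc c a, hcx]
    rw [hg, ha', hb', mul_assoc k, hcab]

end DedekindGroups

section Quaternion

/-- The combinations of two anticommuting square roots of `-1` are definite. -/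
theorem isDefinite_quaternion {D : Type*} [Ring D] [Algebra ℚ D] {i j : D} (hi : i * i = -1)
    (hj : j * j = -1) (hij : j * i = -(i * j)) (w x y z : ℚ) :
    IsDefinite (w • (1 : D) + x • i + y • j + z • (i * j)) := by
  by_cases h0 : x = 0 ∧ y = 0 ∧ z = 0
  · obtain ⟨rfl, rfl, rfl⟩ := h0
    exact .inl ⟨w, by simp [Algebra.algebraMap_eq_smul_one]⟩
  · refine .inr ⟨2 * w, w ^ 2 + x ^ 2 + y ^ 2 + z ^ 2, ?_, ?_⟩
    · have : 0 < x ^ 2 + y ^ 2 + z ^ 2 := by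
        by_contra! h
        apply h0
        refine ⟨?_, ?_, ?_⟩ <;> rw [← sq_eq_zero_iff] <;> nlinarith [sq_nonneg x, sq_nonneg y, sq_nonneg z]
      nlinarith
    · have h1 : i * (i * j) = -j := by rw [← mul_assoc, hi, neg_one_mul]
      have h2 : (i * j) * i = j := by rw [mul_assoc, hij, mul_neg, h1, neg_neg]
      have h3 : (i * j) * j = -i := by rw [mul_assoc, hj, mul_neg_one]
      have h4 : j * (i * j) = i := by rw [← mul_assoc, hij, neg_mul, h3, neg_neg]
      have h5 : (i * j) * (i * j) = -1 := by rw [← mul_assoc, h2, hj]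
      rw [Algebra.algebraMap_eq_smul_one]
      simp only [add_mul, mul_add, smul_mul_assoc, mul_smul_comm, one_mul, mul_one, hi, hj, hij, h1,
        h2, h3, h4, h5, smul_add, smul_smul, smul_neg]
      module

end Quaternion

section HamiltonianAlgebra

open MonoidAlgebra

theorem eq_zero_of_forall_sum_char_eq_zero_of_comm {G : Type*} [Group G] [Fintype G]
    (hc : ∀ a b : G, a * b = b * a) (f : G → ℂ)
    (h : ∀ χ : G →* ℂ, ∑ g, f g * χ g = 0) : f = 0 :=
  let _ : CommGroup G := { (inferInstance : Group G) with mul_comm := hc }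
  eq_zero_of_forall_sum_char_eq_zero f h

theorem lift_mapDomainRingHom {G H A : Type*} [Group G] [Group H] [Ring A] [Algebra ℚ A]
    (f : G →* H) (χ : H →* A) (x : MonoidAlgebra ℚ G) :
    lift ℚ A H χ (mapDomainRingHom ℚ f x) = lift ℚ A G (χ.comp f) x := by
  induction x using MonoidAlgebra.induction_linear with
  | zero => simp
  | add x z hx hz => rw [map_add, map_add, map_add, hx, hz]
  | single g r => simp

variable {G : Type u} [Group G] {a b c : G}

namespace IsQuaternionDecomposition

theorem mem_center_iff (h : IsQuaternionDecomposition a b c) (g : G) :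
    g ∈ Subgroup.center G ↔ g * g = 1 := by
  constructor
  · intro hg
    rw [Subgroup.mem_center_iff] at hg
    have hnab : a * b ≠ b * a := fun hab => by
      rw [h.mul_eq, mul_eq_right] at hab
      exact h.ne_one hab
    obtain ⟨k, hk, hg'⟩ := h.exists_eq g
    have hc : ∀ q p, g = k * q → p * q = q * p := fun q p hq => by
      have := hg p
      rw [hq, ← mul_assoc, ← h.comm_of_sq k hk p, mul_assoc, mul_assoc] at this
      exact mul_left_cancel this
    rcases hg' with rfl | hq | hq | hq
    · exact hk
    · exact absurd (hc _ b hq).symm hnab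
    · exact absurd (hc _ a hq) hnab
    · have := hc _ a hq
      rw [mul_assoc] at this
      exact absurd (mul_left_cancel this) hnab
  · intro hg
    rw [Subgroup.mem_center_iff]
    exact fun k => (h.comm_of_sq g hg k).symm

theorem c_mem_center (h : IsQuaternionDecomposition a b c) : c ∈ Subgroup.center G :=
  (h.mem_center_iff c).2 h.sq_eq_one

/-- A multiple of the central idempotent of a character of the center. -/
noncomputable def centralSum [Finite G] (l : Subgroup.center G →* ℚ) : MonoidAlgebra ℚ G :=
  letI := Fintype.ofFinite (Subgroup.center G)
  ∑ z : Subgroup.center G, single (z : G) (l z)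

theorem single_mul_centralSum [Finite G] (l : Subgroup.center G →* ℚ)
    (w : Subgroup.center G) (hw : l w * l w = 1) : single (w : G) 1 * centralSum l = l w • centralSum l := by
  let _ := Fintype.ofFinite (Subgroup.center G)
  simp only [centralSum, Finset.mul_sum, Finset.smul_sum, single_mul_single, one_mul, smul_single,
    smul_eq_mul]
  refine Fintype.sum_equiv (Equiv.mulLeft w) _ _ fun z => ?_
  simp [← mul_assoc, hw]

theorem centralSum_comm [Finite G] (l : Subgroup.center G →* ℚ) (x : MonoidAlgebra ℚ G) :
    centralSum l * x = x * centralSum l := by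
  let _ := Fintype.ofFinite (Subgroup.center G)
  simp only [centralSum, Finset.mul_sum, Finset.sum_mul]
  refine Finset.sum_congr rfl fun z _ => ?_
  exact (single_commute (fun m => (Subgroup.mem_center_iff.1 z.2 m).symm)
    (fun _ => Commute.all _ _) x)

/-- The ideal annihilated by the central idempotent of a character. -/
noncomputable def charIdeal [Finite G] (l : Subgroup.center G →* ℚ) : Ideal (MonoidAlgebra ℚ G) where
  carrier := {x | x * centralSum l = 0}
  add_mem' := fun {x y} hx hy => by
    rw [Set.mem_ofPred_eq] at *
    rw [add_mul, hx, hy, add_zero]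
  zero_mem' := zero_mul _
  smul_mem' := fun y x hx => by
    rw [Set.mem_ofPred_eq] at *
    rw [smul_eq_mul, mul_assoc, hx, mul_zero]

theorem mem_charIdeal [Finite G] {l : Subgroup.center G →* ℚ} {x : MonoidAlgebra ℚ G} :
    x ∈ charIdeal l ↔ x * centralSum l = 0 := Iff.rfl

instance [Finite G] (l : Subgroup.center G →* ℚ) : (charIdeal l).IsTwoSided :=
  ⟨fun {x} y hx => by
    rw [mem_charIdeal] at *
    rw [mul_assoc, ← centralSum_comm, ← mul_assoc, hx, zero_mul]⟩

theorem coeff_mul_centralSum [Finite G] (l : Subgroup.center G →* ℚ)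
    [inst : Fintype (Subgroup.center G)]
    (x : MonoidAlgebra ℚ G) (g : G) :
    (x * centralSum l).coeff g = ∑ z : Subgroup.center G, x.coeff (g * (z : G)⁻¹) * l z := by
  obtain rfl : inst = Fintype.ofFinite _ := Subsingleton.elim _ _
  rw [centralSum, Finset.mul_sum, coeff_sum, Finsupp.finsetSum_apply]
  refine Finset.sum_congr rfl fun z _ => ?_
  rw [coeff_mul_single_apply]

theorem charIdeal_ne_top [Finite G] (l : Subgroup.center G →* ℚ) : charIdeal l ≠ ⊤ := by
  classical
  let _ := Fintype.ofFinite (Subgroup.center G)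
  rw [Ideal.ne_top_iff_one, mem_charIdeal, one_mul]
  intro h
  have := congrArg (fun x => coeff x 1) h
  rw [← one_mul (centralSum l)] at this
  simp only [coeff_mul_centralSum, one_def, coeff_single, coeff_zero] at this
  rw [Finset.sum_eq_single 1] at this
  · simp at this
  · intro z _ hz
    rw [Finsupp.single_eq_of_ne (by simpa using hz), zero_mul]
  · simp

/-- The quotient by the ideal of a character which is nontrivial on `c` is a quaternion algebra. -/
theorem isDefinite_quotient [Finite G] (h : IsQuaternionDecomposition a b c) (l : Subgroup.center G →* ℚ)
    (hl : ∀ z, l z * l z = 1) (hlc : l ⟨c, h.c_mem_center⟩ = -1) (x : MonoidAlgebra ℚ G) :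
    IsDefinite (Ideal.Quotient.mkₐ ℚ (charIdeal l) x) := by
  set π := Ideal.Quotient.mkₐ ℚ (charIdeal l)
  let m : G →* (MonoidAlgebra ℚ G ⧸ charIdeal l) := (π : _ →* _).comp (of ℚ G)
  have hz : ∀ z : Subgroup.center G, m z = l z • 1 := by
    intro z
    change Ideal.Quotient.mk (charIdeal l) (single (z : G) 1) = _
    have h1 : l z • (1 : MonoidAlgebra ℚ G ⧸ charIdeal l) = Ideal.Quotient.mk (charIdeal l) (l z • 1) :=
      rfl
    rw [h1, Ideal.Quotient.eq, mem_charIdeal, sub_mul, single_mul_centralSum l z (hl z),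
      smul_mul_assoc, one_mul, sub_self]
  have hc : m c = -1 := by rw [hz ⟨c, h.c_mem_center⟩, hlc]; simp
  have hi : m a * m a = -1 := by rw [← map_mul, h.sq_left, hc]
  have hj : m b * m b = -1 := by rw [← map_mul, h.sq_right, hc]
  have hij : m b * m a = -(m a * m b) := by
    rw [← map_mul m a b, h.mul_eq, map_mul m c, hc, map_mul, neg_one_mul, neg_neg]
  have hx : ∃ w x' y z : ℚ, π x = w • 1 + x' • m a + y • m b + z • (m a * m b) := by
    induction x using MonoidAlgebra.induction_linear with
    | zero => exact ⟨0, 0, 0, 0, by simp⟩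
    | add x y hx hy =>
      obtain ⟨w, x', y', z, h1⟩ := hx
      obtain ⟨w2, x2, y2, z2, h2⟩ := hy
      exact ⟨w + w2, x' + x2, y' + y2, z + z2, by rw [map_add, h1, h2]; module⟩
    | single g r =>
      have h1 : π (single g r) = r • m g := by
        rw [show single g r = r • of ℚ G g by simp, map_smul]; rfl
      obtain ⟨k, hk, hg⟩ := h.exists_eq g
      have h2 := hz ⟨k, (h.mem_center_iff k).2 hk⟩
      simp only at h2
      generalize l ⟨k, (h.mem_center_iff k).2 hk⟩ = t at h2
      rw [h1]
      rcases hg with rfl | rfl | rfl | rfl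
      · exact ⟨r * t, 0, 0, 0, by rw [h2]; module⟩
      · exact ⟨0, r * t, 0, 0, by rw [map_mul, h2, smul_mul_assoc, one_mul]; module⟩
      · exact ⟨0, 0, r * t, 0, by rw [map_mul, h2, smul_mul_assoc, one_mul]; module⟩
      · exact ⟨0, 0, 0, r * t, by rw [map_mul, map_mul, h2, smul_mul_assoc, one_mul]; module⟩
  obtain ⟨w, x', y, z, hx⟩ := hx
  rw [hx]
  exact isDefinite_quaternion hi hj hij w x' y z

theorem sq_eq (h : IsQuaternionDecomposition a b c) (g : G) : g * g = 1 ∨ g * g = c := by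
  have hk : ∀ k q : G, k * k = 1 → k * q * (k * q) = q * q := fun k q hk => by
    rw [mul_assoc, ← mul_assoc q, ← h.comm_of_sq k hk, mul_assoc k, ← mul_assoc k k, hk, one_mul]
  obtain ⟨k, hk2, rfl | rfl | rfl | rfl⟩ := h.exists_eq g
  · exact .inl hk2
  · exact .inr (by rw [hk _ _ hk2, h.sq_left])
  · exact .inr (by rw [hk _ _ hk2, h.sq_right])
  · right
    have hba : b * a = c * (a * b) := by rw [h.mul_eq, ← mul_assoc, h.sq_eq_one, one_mul]
    rw [hk _ _ hk2]
    calc a * b * (a * b) = a * (b * a) * b := by simp only [mul_assoc]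
      _ = c * ((a * a) * (b * b)) := by
        rw [hba, ← mul_assoc a c, ← h.comm a]; simp only [mul_assoc]
      _ = c := by rw [h.sq_left, h.sq_right, h.sq_eq_one, mul_one]

theorem commutator_le (h : IsQuaternionDecomposition a b c) :
    commutator G ≤ Subgroup.zpowers c := by
  have hsq : ∀ g, g * g ∈ Subgroup.zpowers c := fun g => by
    rcases h.sq_eq g with h1 | h1 <;> rw [h1]
    · exact one_mem _
    · exact Subgroup.mem_zpowers c
  rw [commutator_def, Subgroup.commutator_le]
  intro x _ y _
  have : x * y * x⁻¹ * y⁻¹ = (x * y * (x * y)) * (y⁻¹ * x⁻¹ * y * (y⁻¹ * x⁻¹ * y)) * (y⁻¹ * y⁻¹) := by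
    group
  rw [commutatorElement_def, this]
  exact mul_mem (mul_mem (hsq _) (hsq _)) (hsq _)

/-- The characters of `G` and the quaternion quotients separate the points of the group algebra. -/
theorem eq_zero_of_forall [Finite G] (h : IsQuaternionDecomposition a b c) (x : MonoidAlgebra ℚ G)
    (hχ : ∀ χ : G →* ℂ, lift ℚ ℂ G χ x = 0)
    (hl : ∀ l : Subgroup.center G →* ℚ, (∀ z, l z * l z = 1) → l ⟨c, h.c_mem_center⟩ = -1 →
      x ∈ charIdeal l) : x = 0 := by
  classical
  let _ := Fintype.ofFinite G
  let _ := Fintype.ofFinite (Subgroup.center G)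
  set cz : Subgroup.center G := ⟨c, h.c_mem_center⟩
  have hzz : ∀ z : Subgroup.center G, z * z = 1 := fun z =>
    Subtype.ext ((h.mem_center_iff z).1 z.2)
  have hxc : ∀ g, x.coeff (g * c) = x.coeff g := by
    intro g
    have h0 := eq_zero_of_forall_sum_char_eq_zero_of_comm (G := Subgroup.center G)
      (fun y z => Subtype.ext (Subgroup.mem_center_iff.1 z.2 y))
      (fun z => (x.coeff (g * z) : ℂ) - x.coeff (g * (cz * z : Subgroup.center G))) ?_
    · have h1 := congrFun h0 1
      simp only [Subgroup.coe_one, mul_one, Pi.zero_apply, sub_eq_zero] at h1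
      exact_mod_cast h1.symm
    · intro χ
      have hsq : ∀ z, χ z = 1 ∨ χ z = -1 := fun z => by
        rw [← mul_self_eq_one_iff, ← map_mul, hzz, map_one]
      have h2 : ∑ z, (x.coeff (g * (cz * z : Subgroup.center G)) : ℂ) * χ z =
          χ cz * ∑ z : Subgroup.center G, (x.coeff (g * z) : ℂ) * χ z := by
        rw [Finset.mul_sum]
        refine Fintype.sum_equiv (Equiv.mulLeft cz) _ _ fun z => ?_
        have h6 : χ cz * χ cz = 1 := by rw [← map_mul, hzz, map_one]
        simp only [Equiv.coe_mulLeft]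
        rw [map_mul χ]
        linear_combination -((x.coeff (g * (cz * z : Subgroup.center G)) : ℂ) * χ z) * h6
      simp only [sub_mul, Finset.sum_sub_distrib]
      rw [h2]
      rcases hsq cz with h3 | h3
      · rw [h3, one_mul, sub_self]
      · choose l' hl' using fun z => show ∃ q : ℚ, (q : ℂ) = χ z by
          rcases hsq z with h | h
          · exact ⟨1, by simp [h]⟩
          · exact ⟨-1, by simp [h]⟩
        let l : Subgroup.center G →* ℚ :=
          { toFun := l'
            map_one' := by
              have : ((l' 1 : ℚ) : ℂ) = (1 : ℚ) := by rw [hl', map_one, Rat.cast_one]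
              exact_mod_cast this
            map_mul' := fun y z => by
              have : ((l' (y * z) : ℚ) : ℂ) = ((l' y * l' z : ℚ) : ℂ) := by
                rw [hl', map_mul]; push_cast; rw [hl', hl']
              exact_mod_cast this }
        have hlz : ∀ z, ((l z : ℚ) : ℂ) = χ z := hl'
        have hx := hl l (fun z => by rw [← map_mul, hzz, map_one]) (by
          have : ((l cz : ℚ) : ℂ) = (-1 : ℚ) := by rw [hlz, h3]; simp
          exact_mod_cast this)
        have h4 := congrArg (fun y => coeff y g) (mem_charIdeal.1 hx)
        simp only [coeff_mul_centralSum, coeff_zero, Finsupp.coe_zero, Pi.zero_apply] at h4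
        have h5 : ∑ z : Subgroup.center G, (x.coeff (g * z) : ℂ) * χ z = 0 := by
          rw [← Rat.cast_zero, ← h4, Rat.cast_sum]
          refine Finset.sum_congr rfl fun z _ => ?_
          rw [Rat.cast_mul, hlz, ← Subgroup.coe_inv, inv_eq_of_mul_eq_one_left (hzz z)]
        rw [h5]; simp
  let y : MonoidAlgebra ℚ (Abelianization G) := mapDomainRingHom ℚ Abelianization.of x
  have hy : y = 0 := by
    refine eq_zero_of_forall_lift_eq_zero y fun χ => ?_
    rw [lift_mapDomainRingHom, hχ]
  have hxx : ∀ g k, (Abelianization.of k : Abelianization G) = Abelianization.of g →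
      x.coeff k = x.coeff g := by
    intro g k hgk
    have h1 : g⁻¹ * k ∈ commutator G := QuotientGroup.eq.1 hgk.symm
    obtain ⟨r, hr⟩ := h.commutator_le h1
    have hr : c ^ r = g⁻¹ * k := hr
    have hc2 : c ^ (2 : ℤ) = 1 := by rw [zpow_two, h.sq_eq_one]
    rw [eq_inv_mul_iff_mul_eq] at hr
    rcases Int.even_or_odd' r with ⟨t, rfl | rfl⟩
    · rw [← hr, zpow_mul, hc2, one_zpow, mul_one]
    · rw [← hr, zpow_add, zpow_mul, hc2, one_zpow, one_mul, zpow_one, hxc]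
  ext g
  have h1 := congrArg (fun w => coeff w (Abelianization.of g)) hy
  have h2 : y.coeff (Abelianization.of g) =
      ∑ k : G, if (Abelianization.of k : Abelianization G) = Abelianization.of g
        then x.coeff k else 0 := by
    change (Finsupp.mapDomain Abelianization.of x.coeff) (Abelianization.of g) = _
    rw [Finsupp.mapDomain, Finsupp.sum_fintype _ _ (by simp), Finsupp.finsetSum_apply]
    exact Finset.sum_congr rfl fun k _ => by rw [Finsupp.single_apply]
  rw [Finset.sum_congr rfl (g := fun k : G =>
      if (Abelianization.of k : Abelianization G) = Abelianization.of g
        then x.coeff g else 0) (fun k _ => by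
          split_ifs with h3
          · exact hxx g k h3
          · rfl), ← Finset.sum_filter, Finset.sum_const] at h2
  simp only [h2, coeff_zero, Finsupp.coe_zero, Pi.zero_apply] at h1
  refine (smul_eq_zero.1 h1).resolve_left ?_
  exact (Finset.card_pos.2 ⟨g, by simp⟩).ne'

end IsQuaternionDecomposition

/-- The rational group algebra of a Hamiltonian `2`-group. -/
theorem isReduced_and_hasTorsionIntegralUnits_of_hamiltonian [Finite G]
    (hG : IsHamiltonianTwoGroup G) :
    IsReduced (MonoidAlgebra ℚ G) ∧ HasTorsionIntegralUnits (MonoidAlgebra ℚ G) := by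
  obtain ⟨a, b, c, h⟩ := exists_quaternionDecomposition hG.1 hG.2.1 hG.2.2
  have key : ∀ (χ : G →* ℂ) x, IsDefinite (lift ℚ ℂ G χ x) := fun χ x =>
    isDefinite_lift_of_pow_four χ (fun g => by
      rw [← map_pow, show 4 = 2 * 2 from rfl, pow_mul, sq g]
      rcases h.sq_eq g with h1 | h1
      · rw [h1, one_pow, map_one]
      · rw [h1, sq, h.sq_eq_one, map_one]) x
  have hnt : ∀ l : Subgroup.center G →* ℚ,
      Nontrivial (MonoidAlgebra ℚ G ⧸ IsQuaternionDecomposition.charIdeal l) := fun l =>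
    Ideal.Quotient.nontrivial_iff.2 (IsQuaternionDecomposition.charIdeal_ne_top l)
  refine ⟨isReduced_of_mul_self fun x hx => ?_, fun u v huv hvu hu hv => ?_⟩
  · refine h.eq_zero_of_forall x (fun χ => map_eq_zero_of_mul_self _ (key χ) hx) fun l hl hlc => ?_
    have := hnt l
    rw [← Ideal.Quotient.eq_zero_iff_mem]
    exact map_eq_zero_of_mul_self _ (h.isDefinite_quotient l hl hlc) hx
  · rw [← sub_eq_zero]
    refine h.eq_zero_of_forall _ (fun χ => ?_) fun l hl hlc => ?_
    · rw [map_sub, map_pow_twelve_eq_one _ (key χ) huv hvu hu hv, map_one, sub_self]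
    · have := hnt l
      rw [← Ideal.Quotient.eq, map_one]
      exact map_pow_twelve_eq_one _ (h.isDefinite_quotient l hl hlc) huv hvu hu hv

end HamiltonianAlgebra

section ResidueFields

open MonoidAlgebra NumberField

variable {A : Type*} [Ring A] [Module ℚ A] {Γ : Subring A} {T : Type*} [CommGroup T]
  {n : ℕ} [NeZero n] {K : Type*} [Field K] [NumberField K] [IsCyclotomicExtension {n} ℚ K]

theorem lift_surjective_of_primitiveRoot (χ : T →* K) {t : T}
    (ht : IsPrimitiveRoot (χ t) n) :
    Function.Surjective (lift ℚ K T χ) := by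
  have h1 : Algebra.adjoin ℚ {χ t} ≤ (lift ℚ K T χ).range := by
    rw [Algebra.adjoin_le_iff, Set.singleton_subset_iff]
    exact ⟨single t 1, by simp⟩
  rw [IsCyclotomicExtension.adjoin_primitive_root_eq_top ht, top_le_iff] at h1
  exact AlgHom.range_eq_top _ |>.1 h1

theorem totient_le_four_of_primitiveRoot [Finite T] (hA : HasHyperbolicProperty A) (hΓ : IsZOrder Γ)
    (φ : MonoidAlgebra ℚ T →ₙ+* A) (hφ : Function.Injective φ) (χ : T →* K) {t : T}
    (ht : IsPrimitiveRoot (χ t) n) : n.totient ≤ 4 := by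
  by_cases hn : 2 < n
  · have h := hA.rank_le_one hΓ φ hφ (lift ℚ K T χ : _ →+* K) (lift_surjective_of_primitiveRoot χ ht)
    rw [rank_of_isCyclotomicExtension K n hn] at h
    obtain ⟨k, hk⟩ := Nat.totient_even hn
    omega
  · exact (Nat.totient_le n).trans (by omega)

theorem totient_le_two_of_primitiveRoot [Finite T] (hA : HasHyperbolicProperty A) (hΓ : IsZOrder Γ)
    (φ : MonoidAlgebra ℚ T →ₙ+* A) (hφ : Function.Injective φ) (χ ψ : T →* K) {t t' s : T}
    (ht : IsPrimitiveRoot (χ t) n) (ht' : IsPrimitiveRoot (ψ t') n) (hs : χ s = 1) (hs' : ψ s ≠ 1) :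
    n.totient ≤ 2 := by
  by_cases hn : 2 < n
  · have h := hA.rank_eq_zero_or hΓ φ hφ (lift ℚ K T χ : _ →+* K)
      (lift_surjective_of_primitiveRoot χ ht)
      (lift ℚ K T ψ : _ →+* K) (lift_surjective_of_primitiveRoot ψ ht') ?_
    · rw [rank_of_isCyclotomicExtension K n hn] at h
      obtain ⟨k, hk⟩ := Nat.totient_even hn
      omega
    · intro hker
      have h1 : (single s 1 - 1 : MonoidAlgebra ℚ T) ∈ RingHom.ker (lift ℚ K T χ : _ →+* K) := by
        simp [RingHom.mem_ker, hs]
      rw [hker] at h1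
      simp [RingHom.mem_ker, sub_eq_zero] at h1
      exact hs' h1
  · exact (Nat.totient_le n).trans (by omega)

end ResidueFields

section ElementOrders

open MonoidAlgebra

theorem mem_of_totient_le_four {n : ℕ} (hn : n ≠ 0) (h : n.totient ≤ 4) :
    n ∈ ({1, 2, 3, 4, 5, 6, 8, 10, 12} : Finset ℕ) := by
  have h120 : n ∣ 120 := by
    rw [Nat.dvd_iff_prime_pow_dvd_dvd]
    intro p k hp hpk
    have h1 : (p ^ k).totient ≤ 4 :=
      (Nat.le_of_dvd (Nat.totient_pos.2 (Nat.pos_of_ne_zero hn)) (Nat.totient_dvd_of_dvd hpk)).trans h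
    rcases k with _ | k
    · simp
    rw [Nat.totient_prime_pow_succ hp] at h1
    have hpos : 0 < p ^ k := pow_pos hp.pos k
    have hp5 : p ≤ 5 := by
      have := (Nat.le_mul_of_pos_left (p - 1) hpos).trans h1
      omega
    have hp2 := hp.two_le
    interval_cases p
    · have : 2 ^ k < 2 ^ 3 := by omega
      have := (Nat.pow_lt_pow_iff_right one_lt_two).1 this
      interval_cases k <;> norm_num
    · have : 3 ^ k < 3 ^ 1 := by omega
      have := (Nat.pow_lt_pow_iff_right (by norm_num)).1 this
      interval_cases k; norm_num
    · exact absurd hp (by norm_num)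
    · have : 5 ^ k < 5 ^ 1 := by omega
      have := (Nat.pow_lt_pow_iff_right (by norm_num)).1 this
      interval_cases k; norm_num
  have hmem : n ∈ Nat.divisors 120 := by simp [h120]
  have hall : ∀ m ∈ Nat.divisors 120, m.totient ≤ 4 →
      m ∈ ({1, 2, 3, 4, 5, 6, 8, 10, 12} : Finset ℕ) := by decide +kernel
  exact hall n hmem h

variable {A : Type*} [Ring A] [Module ℚ A] {Γ : Subring A} {G : Type u} [Group G] [Finite G]

/-- The possible orders of the elements of a group whose algebra embeds in a hyperbolic algebra. -/
theorem orderOf_mem_of_hyperbolic (hA : HasHyperbolicProperty A) (hΓ : IsZOrder Γ)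
    (φ : MonoidAlgebra ℚ G →ₙ+* A) (hφ : Function.Injective φ) (g : G) :
    orderOf g ∈ ({1, 2, 3, 4, 5, 6, 8, 12} : Finset ℕ) := by
  let T := Subgroup.zpowers g
  let _ : CommGroup T :=
    { (inferInstance : Group T) with
      mul_comm := by
        rintro ⟨_, k, rfl⟩ ⟨_, l, rfl⟩
        exact Subtype.ext (zpow_mul_comm g k l) }
  let t : T := ⟨g, Subgroup.mem_zpowers g⟩
  have ht : ∀ x : T, x ∈ Subgroup.zpowers t := by
    rintro ⟨_, k, rfl⟩
    exact ⟨k, rfl⟩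
  have hto : orderOf t = orderOf g := by rw [← Subgroup.orderOf_coe]
  let φ' : MonoidAlgebra ℚ T →ₙ+* A := φ.comp (mapDomainRingHom ℚ T.subtype : _ →ₙ+* _)
  have hφ' : Function.Injective φ' := hφ.comp (mapDomain_injective Subtype.val_injective)
  have hn0 : orderOf g ≠ 0 := (orderOf_pos g).ne'
  have hchar : ∀ (K : Type) [Field K] (ζ : Kˣ), orderOf ζ ∣ orderOf g → ∃ χ : T →* K, χ t = ζ := by
    intro K _ ζ hζ
    refine ⟨(Units.coeHom K).comp (monoidHomOfForallMemZpowers ht (g' := ζ) (by rwa [hto])), ?_⟩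
    change ((monoidHomOfForallMemZpowers ht _ t : Kˣ) : K) = ζ
    rw [monoidHomOfForallMemZpowers_apply_gen]
  have h4 : (orderOf g).totient ≤ 4 := by
    have : NeZero (orderOf g) := ⟨hn0⟩
    let K := CyclotomicField (orderOf g) ℚ
    have : IsCyclotomicExtension {orderOf g} ℚ K := CyclotomicField.isCyclotomicExtension _ ℚ
    have hζ := IsCyclotomicExtension.zeta_spec (orderOf g) ℚ K
    obtain ⟨ζ, h1⟩ := hζ.isUnit hn0
    rw [← h1] at hζ
    obtain ⟨χ, hχ⟩ := hchar K ζ (by rw [← (IsPrimitiveRoot.coe_units_iff.1 hζ).eq_orderOf])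
    exact totient_le_four_of_primitiveRoot hA hΓ φ' hφ' χ (t := t) (by rwa [hχ])
  have h10 : orderOf g ≠ 10 := by
    intro h10
    let K := CyclotomicField 5 ℚ
    have : IsCyclotomicExtension {5} ℚ K := CyclotomicField.isCyclotomicExtension _ ℚ
    have hζ := IsCyclotomicExtension.zeta_spec 5 ℚ K
    obtain ⟨ζ, h1⟩ := hζ.isUnit (by norm_num)
    rw [← h1] at hζ
    have h5 : ζ ^ 5 = 1 := (IsPrimitiveRoot.coe_units_iff.1 hζ).pow_eq_one
    obtain ⟨χ, hχ⟩ := hchar K ζ (orderOf_dvd_of_pow_eq_one (by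
      rw [h10, show 10 = 5 * 2 from rfl, pow_mul, h5, one_pow]))
    obtain ⟨ψ, hψ⟩ := hchar K (-ζ) (orderOf_dvd_of_pow_eq_one (by
      rw [h10, Even.neg_pow (by decide), show 10 = 5 * 2 from rfl, pow_mul, h5, one_pow]))
    have h5' : (ζ : K) ^ 5 = 1 := hζ.pow_eq_one
    have h2 := totient_le_two_of_primitiveRoot hA hΓ φ' hφ' χ ψ (t := t) (t' := t ^ 6) (s := t ^ 5)
      (n := 5) (by rwa [hχ]) (by
        rw [map_pow, hψ]; push_cast
        rw [Even.neg_pow (by decide), pow_succ, h5', one_mul]; exact hζ)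
      (by rw [map_pow, hχ, h5'])
      (by
        rw [map_pow, hψ]; push_cast
        rw [Odd.neg_pow (by decide), h5']
        norm_num)
    revert h2
    decide
  have := mem_of_totient_le_four hn0 h4
  simp only [Finset.mem_insert, Finset.mem_singleton] at this ⊢
  omega

end ElementOrders

section AbelianGroups

/-- A noncyclic abelian group of exponent `5`, `8` or `12` has two different cyclic subgroups of
maximal order. -/
theorem exists_orderOf_eq_notMem_zpowers {D : Type*} [CommGroup D] {N : ℕ}
    (hN : N = 5 ∨ N = 8 ∨ N = 12) (hexp : ∀ x : D, x ^ N = 1) {x : D} (hx : orderOf x = N)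
    (hnc : ∃ y, y ∉ Subgroup.zpowers x) : ∃ y, orderOf y = N ∧ y ∉ Subgroup.zpowers x := by
  obtain ⟨y, hy⟩ := hnc
  have hnot : ∀ k : ℕ, x ^ k * y ∉ Subgroup.zpowers x := fun k h =>
    hy ((Subgroup.mul_mem_cancel_left _ (Subgroup.npow_mem_zpowers x k)).1 h)
  have hxne : ∀ k, ¬ N ∣ k → x ^ k ≠ 1 := fun k hk h => hk (hx ▸ orderOf_dvd_of_pow_eq_one h)
  have hdvd : ∀ z : D, orderOf z ∣ N := fun z => orderOf_dvd_of_pow_eq_one (hexp z)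
  rcases hN with rfl | rfl | rfl
  · refine ⟨y, ?_, hy⟩
    rcases (Nat.dvd_prime (by norm_num)).1 (hdvd y) with h | h
    · rw [orderOf_eq_one_iff] at h
      exact absurd (h ▸ one_mem _) hy
    · exact h
  · have h8 : ∀ z : D, z ^ 4 ≠ 1 → orderOf z = 8 := by
      intro z hz
      have h1 := hdvd z
      have h2 : ¬ orderOf z ∣ 4 := fun h => hz (orderOf_dvd_iff_pow_eq_one.1 h)
      have h3 := Nat.le_of_dvd (by norm_num) h1
      generalize orderOf z = d at *
      interval_cases d <;> omega
    by_cases h : y ^ 4 = 1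
    · refine ⟨x ^ 1 * y, h8 _ ?_, hnot 1⟩
      rw [mul_pow, h, mul_one, ← pow_mul]
      exact hxne _ (by norm_num)
    · exact ⟨y, h8 _ h, hy⟩
  · have h12 : ∀ z : D, z ^ 4 ≠ 1 → z ^ 6 ≠ 1 → orderOf z = 12 := by
      intro z hz hz'
      have h1 := hdvd z
      have h2 : ¬ orderOf z ∣ 4 := fun h => hz (orderOf_dvd_iff_pow_eq_one.1 h)
      have h2' : ¬ orderOf z ∣ 6 := fun h => hz' (orderOf_dvd_iff_pow_eq_one.1 h)
      have h3 := Nat.le_of_dvd (by norm_num) h1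
      generalize orderOf z = d at *
      interval_cases d <;> omega
    by_cases hy4 : y ^ 4 ∈ Subgroup.zpowers x
    · -- replace `y` by its `2`-part
      have hz : y ^ 9 ∉ Subgroup.zpowers x := by
        intro h9
        apply hy
        have : y = y ^ 9 * y ^ 4 := by
          rw [← pow_add, show 9 + 4 = 12 + 1 from rfl, pow_succ, hexp, one_mul]
        rw [this]
        exact mul_mem h9 hy4
      have hznot : ∀ k : ℕ, x ^ k * y ^ 9 ∉ Subgroup.zpowers x := fun k h =>
        hz ((Subgroup.mul_mem_cancel_left _ (Subgroup.npow_mem_zpowers x k)).1 h)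
      have hz4 : (y ^ 9) ^ 4 = 1 := by
        rw [← pow_mul, show 9 * 4 = 12 * 3 from rfl, pow_mul, hexp, one_pow]
      have hz6 : (y ^ 9) ^ 6 = (y ^ 9) ^ 2 := by
        rw [show 6 = 4 + 2 from rfl, pow_add, hz4, one_mul]
      by_cases h6 : x ^ 6 * (y ^ 9) ^ 2 = 1
      · refine ⟨x ^ 4 * y ^ 9, h12 _ ?_ ?_, hznot 4⟩
        · rw [mul_pow, hz4, mul_one, ← pow_mul]
          exact hxne _ (by norm_num)
        · rw [mul_pow, hz6, ← pow_mul, show 4 * 6 = 12 * 2 from rfl, pow_mul, hexp, one_pow, one_mul]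
          intro h
          rw [h, mul_one] at h6
          exact hxne _ (by norm_num) h6
      · refine ⟨x ^ 1 * y ^ 9, h12 _ ?_ ?_, hznot 1⟩
        · rw [mul_pow, hz4, mul_one, ← pow_mul]
          exact hxne _ (by norm_num)
        · rw [mul_pow, hz6, ← pow_mul]
          exact h6
    · refine ⟨x ^ 1 * y ^ 4, h12 _ ?_ ?_, fun h =>
        hy4 ((Subgroup.mul_mem_cancel_left _ (Subgroup.npow_mem_zpowers x 1)).1 h)⟩
      · intro h
        apply hy4
        have h16 : (y ^ 4) ^ 4 = y ^ 4 := by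
          rw [← pow_mul, show 4 * 4 = 12 + 4 from rfl, pow_add, hexp, one_mul]
        rw [mul_pow, h16, ← pow_mul] at h
        rw [← inv_eq_of_mul_eq_one_right h]
        exact inv_mem (Subgroup.npow_mem_zpowers x _)
      · rw [mul_pow, ← pow_mul y, show 4 * 6 = 12 * 2 from rfl, pow_mul y, hexp, one_pow, mul_one,
          ← pow_mul]
        exact hxne _ (by norm_num)

theorem exists_primitiveRoot_of_orderOf {G K : Type*} [CommGroup G] [Finite G] [Field K]
    (χ : G →* Kˣ) : ∃ s, IsPrimitiveRoot (χ s) (orderOf χ) := by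
  have : Finite χ.range := Set.finite_range χ
  obtain ⟨⟨_, s, rfl⟩, hs⟩ := Monoid.exists_orderOf_eq_exponent
    (Monoid.ExponentExists.of_finite (G := χ.range))
  refine ⟨s, ?_⟩
  have h1 : orderOf (χ s) = Monoid.exponent χ.range := by rw [← hs, ← Subgroup.orderOf_coe]
  have h2 : orderOf (χ s) = orderOf χ := by
    apply Nat.dvd_antisymm
    · rw [orderOf_dvd_iff_pow_eq_one]
      exact DFunLike.congr_fun (pow_orderOf_eq_one χ) s
    · rw [orderOf_dvd_iff_pow_eq_one, h1]
      ext t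
      have h3 : (⟨χ t, t, rfl⟩ : χ.range) ^ Monoid.exponent χ.range = 1 :=
        Monoid.pow_exponent_eq_one _
      have h4 := congrArg (fun z : χ.range => ((z : Kˣ) : K)) h3
      simpa using h4
  rw [← h2]
  exact IsPrimitiveRoot.orderOf _

theorem mem_zpowers_of_ker_le {G K : Type*} [CommGroup G] [Field K] {N : ℕ} [NeZero N]
    {χ ψ : G →* Kˣ} {s : G} (hs : IsPrimitiveRoot (χ s) N) (hχ : χ ^ N = 1) (hψ : ψ ^ N = 1)
    (hker : ∀ t, χ t = 1 → ψ t = 1) : ψ ∈ Subgroup.zpowers χ := by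
  have hroot : ∀ (η : G →* Kˣ) t, η ^ N = 1 → η t ∈ Subgroup.zpowers (χ s) := by
    intro η t hη
    rw [hs.zpowers_eq, mem_rootsOfUnity]
    simpa using DFunLike.congr_fun hη t
  obtain ⟨k, hk⟩ := hroot ψ s hψ
  have hk : χ s ^ k = ψ s := hk
  refine ⟨k, MonoidHom.ext fun t => ?_⟩
  obtain ⟨j, hj⟩ := hroot χ t hχ
  have hj : χ s ^ j = χ t := hj
  have h1 : ψ (t * (s ^ j)⁻¹) = 1 := hker _ (by
    rw [map_mul, map_inv, map_zpow, hj, mul_inv_cancel])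
  rw [map_mul, map_inv, map_zpow, mul_inv_eq_one] at h1
  change (χ ^ k) t = ψ t
  rw [h1, ← hk, MonoidHom.zpow_apply, ← hj, zpow_comm]

end AbelianGroups

section GroupConditions

open MonoidAlgebra

variable {A : Type*} [Ring A] [Module ℚ A] {Γ : Subring A}

theorem isHigmanGroup_or_of_comm {G : Type u} [CommGroup G] [Finite G]
    (hA : HasHyperbolicProperty A) (hΓ : IsZOrder Γ)
    (φ : MonoidAlgebra ℚ G →ₙ+* A) (hφ : Function.Injective φ) :
    IsHigmanGroup G ∨ IsC5OrC8OrC12 G := by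
  obtain ⟨g, hg⟩ := Monoid.exists_orderOf_eq_exponent (Monoid.ExponentExists.of_finite (G := G))
  by_cases h46 : Monoid.exponent G ∣ 4 ∨ Monoid.exponent G ∣ 6
  · exact .inl ⟨inferInstance, .inl ⟨mul_comm, h46⟩⟩
  right
  have hmem := orderOf_mem_of_hyperbolic hA hΓ φ hφ g
  rw [hg] at hmem
  have hN : Monoid.exponent G = 5 ∨ Monoid.exponent G = 8 ∨ Monoid.exponent G = 12 := by
    simp only [Finset.mem_insert, Finset.mem_singleton] at hmem
    generalize Monoid.exponent G = N at *
    rcases hmem with rfl | rfl | rfl | rfl | rfl | rfl | rfl | rfl <;> omega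
  have hcyc : ∀ y, y ∈ Subgroup.zpowers g := by
    by_contra! hnc
    set N := Monoid.exponent G with hNdef
    have hN0 : NeZero N := ⟨by rcases hN with h | h | h <;> rw [h] <;> norm_num⟩
    let K := CyclotomicField N ℚ
    have : IsCyclotomicExtension {N} ℚ K := CyclotomicField.isCyclotomicExtension _ ℚ
    have hζ := IsCyclotomicExtension.zeta_spec N ℚ K
    have : HasEnoughRootsOfUnity K (Monoid.exponent G) :=
      { prim := ⟨_, hζ⟩
        cyc := inferInstance }
    obtain ⟨e⟩ := CommGroup.monoidHom_mulEquiv_of_hasEnoughRootsOfUnity G K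
    obtain ⟨y, hy, hyg⟩ := exists_orderOf_eq_notMem_zpowers hN
      (fun x => Monoid.pow_exponent_eq_one x) hg hnc
    have hχ : orderOf (e.symm g) = N := by rw [MulEquiv.orderOf_eq, hg]
    have hψ : orderOf (e.symm y) = N := by rw [MulEquiv.orderOf_eq, hy]
    obtain ⟨s, hs⟩ := exists_primitiveRoot_of_orderOf (e.symm g)
    obtain ⟨s', hs'⟩ := exists_primitiveRoot_of_orderOf (e.symm y)
    rw [hχ] at hs
    rw [hψ] at hs'
    have hker : ∃ t, e.symm g t = 1 ∧ e.symm y t ≠ 1 := by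
      by_contra! hker
      obtain ⟨k, hk⟩ := mem_zpowers_of_ker_le hs (orderOf_dvd_iff_pow_eq_one.1 hχ.dvd)
        (orderOf_dvd_iff_pow_eq_one.1 hψ.dvd) hker
      refine hyg ⟨k, e.symm.injective ?_⟩
      simpa using hk
    obtain ⟨t, ht, ht'⟩ := hker
    have h2 := totient_le_two_of_primitiveRoot hA hΓ φ hφ ((Units.coeHom K).comp (e.symm g))
      ((Units.coeHom K).comp (e.symm y)) (t := s) (t' := s') (s := t) (n := N)
      (IsPrimitiveRoot.coe_units_iff.2 hs) (IsPrimitiveRoot.coe_units_iff.2 hs')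
      (by simp [ht]) (by simpa using ht')
    rcases hN with h | h | h <;> rw [h] at h2 <;> revert h2 <;> decide
  have hcard : Nat.card G = Monoid.exponent G := by
    rw [← hg, orderOf_eq_card_of_forall_mem_zpowers hcyc]
  have hiso := (zmodCyclicMulEquiv (G := G) ⟨g, hcyc⟩).symm
  rw [hcard] at hiso
  rcases hN with h | h | h <;> rw [h] at hiso
  · exact .inl ⟨hiso⟩
  · exact .inr (.inl ⟨hiso⟩)
  · exact .inr (.inr ⟨hiso⟩)

/-- In a group with reduced group algebra all subgroups are normal. -/
theorem normal_of_isReduced {G : Type u} [Group G] [Finite G] (hred : IsReduced (MonoidAlgebra ℚ G))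
    (H : Subgroup G) : H.Normal := by
  classical
  have := Fintype.ofFinite G
  have := Fintype.ofFinite H
  have hcard : (Fintype.card H : ℚ) ≠ 0 := by exact_mod_cast Fintype.card_ne_zero
  let x : MonoidAlgebra ℚ G := ∑ h : H, single (h : G) 1
  have hx : ∀ h : H, single (h : G) 1 * x = x := by
    intro h
    simp only [x, Finset.mul_sum, single_mul_single, one_mul]
    exact Fintype.sum_equiv (Equiv.mulLeft h) _ _ fun k => by simp
  have hxx : x * x = (Fintype.card H : ℚ) • x := by
    conv_lhs => rw [show x * x = (∑ h : H, single (h : G) 1) * x from rfl, Finset.sum_mul]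
    simp [hx, Nat.cast_smul_eq_nsmul]
  have hnf : NilpotentFree (MonoidAlgebra ℚ G) :=
    (nilpotentFree_iff_of_ringEquiv (RingEquiv.refl _)).2 hred
  have hcomm := hnf.commute_of_isIdempotentElem (e := (Fintype.card H : ℚ)⁻¹ • x) (by
    rw [smul_mul_smul_comm, hxx, smul_smul, mul_assoc, inv_mul_cancel₀ hcard, mul_one])
  have hcoeff : ∀ g, x.coeff g = if g ∈ H then 1 else 0 := by
    intro g
    simp only [x, coeff_sum, Finsupp.finsetSum_apply, coeff_single]
    split_ifs with hg
    · rw [Finset.sum_eq_single ⟨g, hg⟩]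
      · simp
      · intro k _ hk
        exact Finsupp.single_eq_of_ne fun h => hk (Subtype.ext h.symm)
      · simp
    · refine Finset.sum_eq_zero fun k _ => Finsupp.single_eq_of_ne ?_
      rintro rfl
      exact hg k.2
  refine ⟨fun h hh g => ?_⟩
  have h1 := hcomm (single g 1)
  rw [smul_mul_assoc, mul_smul_comm] at h1
  have h2 := smul_right_injective _ (inv_ne_zero hcard) h1
  have h3 := congrArg (fun y => coeff y (g * h)) h2
  simp only [coeff_mul_single_apply, coeff_single_mul_apply, mul_one, hcoeff,
    inv_mul_cancel_left, hh, if_true] at h3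
  by_contra hne
  rw [if_neg hne] at h3
  exact zero_ne_one h3

end GroupConditions

section NonabelianGroups

theorem commute_of_prime_orderOf {G : Type*} [Group G] (hn : ∀ H : Subgroup G, H.Normal) {w : G}
    (hw : (orderOf w).Prime) (y : G) : w * y = y * w := by
  by_contra hne
  have hw0 : IsOfFinOrder w := orderOf_pos_iff.1 hw.pos
  obtain ⟨m, hm⟩ := (hw0.mem_powers_iff_mem_zpowers (y := w * y * w⁻¹ * y⁻¹)).2
    (commutator_mem_zpowers_left hn w y)
  have hm : w ^ m = w * y * w⁻¹ * y⁻¹ := hm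
  have hcop : m.Coprime (orderOf w) := by
    refine ((Nat.Prime.coprime_iff_not_dvd hw).2 fun h => hne ?_).symm
    rw [orderOf_dvd_iff_pow_eq_one.1 h] at hm
    rw [← mul_inv_eq_one, mul_inv_rev, ← mul_assoc, ← hm]
  obtain ⟨l, hl⟩ := exists_pow_eq_self_of_coprime hcop
  rw [hm] at hl
  exact hne (commute_of_mem_zpowers (hl ▸ pow_mem (commutator_mem_zpowers_right hn w y) l))

theorem exists_pow_orderOf_eq_four_or_eight {G : Type*} [Group G]
    (hn : ∀ H : Subgroup G, H.Normal) {u v : G}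
    (hu : orderOf u ∈ ({1, 2, 3, 4, 5, 6, 8, 12} : Finset ℕ)) (huv : u * v ≠ v * u) :
    ∃ k, (orderOf (u ^ k) = 4 ∨ orderOf (u ^ k) = 8) ∧ u ^ k * v ≠ v * u ^ k := by
  have hprime : ∀ k, (orderOf (u ^ k)).Prime → u ^ k * v = v * u ^ k := fun k hk =>
    commute_of_prime_orderOf hn hk v
  have h1 : ¬ (orderOf u).Prime := fun h => huv (commute_of_prime_orderOf hn h v)
  simp only [Finset.mem_insert, Finset.mem_singleton] at hu
  rcases hu with h | h | h | h | h | h | h | h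
  · rw [orderOf_eq_one_iff] at h
    simp [h] at huv
  · rw [h] at h1; norm_num at h1
  · rw [h] at h1; norm_num at h1
  · exact ⟨1, by simp [h, huv]⟩
  · rw [h] at h1; norm_num at h1
  · refine absurd ?_ huv
    have h3 := hprime 3 (by rw [orderOf_pow' _ (by norm_num), h]; norm_num)
    have h4 := hprime 4 (by rw [orderOf_pow' _ (by norm_num), h]; norm_num)
    have h7 : u = u ^ 3 * u ^ 4 := by
      rw [← pow_add, show 3 + 4 = 6 + 1 from rfl, pow_succ, ← h, pow_orderOf_eq_one, one_mul]
    rw [h7, mul_assoc, h4, ← mul_assoc, h3, mul_assoc]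
  · exact ⟨1, by simp [h, huv]⟩
  · refine ⟨9, .inl (by rw [orderOf_pow' _ (by norm_num), h]; norm_num), fun h9 => huv ?_⟩
    have h4 := hprime 4 (by rw [orderOf_pow' _ (by norm_num), h]; norm_num)
    have h13 : u = u ^ 9 * u ^ 4 := by
      rw [← pow_add, show 9 + 4 = 12 + 1 from rfl, pow_succ, ← h, pow_orderOf_eq_one, one_mul]
    rw [h13, mul_assoc, h4, ← mul_assoc, h9, mul_assoc]

/-- The square-zero element witnessing that `ℚ[Q₈ × C₃]` has nilpotents. -/
theorem nilpotent_identity {R : Type*} [Ring R] {a b c x : R} (haa : a * a = c) (hbb : b * b = c)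
    (hba : b * a = c * (a * b)) (hac : a * c = c * a) (hbc : b * c = c * b) (hcc : c * c = 1)
    (hax : a * x = x * a) (hbx : b * x = x * b) (hcx : c * x = x * c) (hx : x * (x * x) = 1) :
    ((a + x * b + x * x * (a * b)) * ((1 - c) * (1 - x))) *
      ((a + x * b + x * x * (a * b)) * ((1 - c) * (1 - x))) = 0 := by
  have hsq : (a + x * b + x * x * (a * b)) * (a + x * b + x * x * (a * b))
      = (1 + x + x * x) * c + (a + x * (a * b) + x * x * b) * (1 + c) := by
    have haa' : ∀ r, a * (a * r) = c * r := fun r => by rw [← mul_assoc, haa]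
    have hba' : ∀ r, b * (a * r) = c * (a * (b * r)) := fun r => by
      rw [← mul_assoc, hba, mul_assoc, mul_assoc]
    have hac' : ∀ r, a * (c * r) = c * (a * r) := fun r => by rw [← mul_assoc, hac, mul_assoc]
    have hcc' : ∀ r, c * (c * r) = r := fun r => by rw [← mul_assoc, hcc, one_mul]
    have hax' : ∀ r, a * (x * r) = x * (a * r) := fun r => by rw [← mul_assoc, hax, mul_assoc]
    have hbx' : ∀ r, b * (x * r) = x * (b * r) := fun r => by rw [← mul_assoc, hbx, mul_assoc]
    have hx' : ∀ r, x * (x * (x * r)) = r := fun r => by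
      rw [← mul_assoc x x r, ← mul_assoc, hx, one_mul]
    simp only [mul_add, add_mul, mul_assoc, one_mul, mul_one, haa, hbb, hba, hac, hbc, haa',
      hba', hac', hcc', hax', hbx', hx']
    abel
  have hd : ((1 - c) * (1 - x)) * (a + x * b + x * x * (a * b))
      = (a + x * b + x * x * (a * b)) * ((1 - c) * (1 - x)) := by
    have key : ∀ z, Commute z a → Commute z b → Commute z x →
        Commute z (a + x * b + x * x * (a * b)) := fun z h1 h2 h3 =>
      (h1.add_right (h3.mul_right h2)).add_right ((h3.mul_right h3).mul_right (h1.mul_right h2))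
    have hc : Commute (1 - c) (a + x * b + x * x * (a * b)) :=
      (Commute.one_left _).sub_left (key c hac.symm hbc.symm hcx)
    have hx : Commute (1 - x) (a + x * b + x * x * (a * b)) :=
      (Commute.one_left _).sub_left (key x hax.symm hbx.symm rfl)
    exact hc.mul_left hx
  have h1 : (1 + c) * (1 - c) = 0 := by simp only [mul_sub, mul_one, add_mul, one_mul, hcc]; abel
  have h2 : c * ((1 - c) * (1 - x)) = (1 - x) * (c * (1 - c)) := by
    have hcx : Commute c (1 - x) := (Commute.one_right c).sub_right hcx
    have h1x : Commute (1 - c) (1 - x) := (Commute.one_left _).sub_left hcx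
    rw [← mul_assoc, (hcx.mul_left h1x).eq]
  have h3 : (1 + x + x * x) * (1 - x) = 0 := by
    simp only [mul_sub, mul_one, add_mul, one_mul, mul_assoc, hx]; abel
  calc _ = (a + x * b + x * x * (a * b)) * (((1 - c) * (1 - x)) *
        (a + x * b + x * x * (a * b))) * ((1 - c) * (1 - x)) := by simp only [mul_assoc]
    _ = ((a + x * b + x * x * (a * b)) * (a + x * b + x * x * (a * b))) *
        ((1 - c) * (1 - x)) * ((1 - c) * (1 - x)) := by rw [hd]; simp only [mul_assoc]
    _ = 0 := by
      rw [hsq, add_mul, mul_assoc _ c, h2, ← mul_assoc (1 + x + x * x), h3, zero_mul, zero_add,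
        mul_assoc _ (1 + c), ← mul_assoc (1 + c), h1, zero_mul, mul_zero, zero_mul]

open MonoidAlgebra

theorem not_isReduced_of_quaternion_mul_three {G : Type u} [Group G] {a b c x : G}
    (haa : a * a = c) (hbb : b * b = c) (hcc : c * c = 1) (hab : a * b = c * (b * a))
    (hne : a * b ≠ b * a) (hx : ∀ y, x * y = y * x) (hx3 : x ^ 3 = 1) (hx1 : x ≠ 1) :
    ¬ IsReduced (MonoidAlgebra ℚ G) := by
  classical
  intro hred
  have hac : a * c = c * a := by rw [← haa, mul_assoc]
  have hbc : b * c = c * b := by rw [← hbb, mul_assoc]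
  have hba : b * a = c * (a * b) := by rw [hab, ← mul_assoc, hcc, one_mul]
  have hc1 : c ≠ 1 := fun h => hne (by rw [hab, h, one_mul])
  have hxx : x * (x * x) = 1 := by rw [← hx3, pow_succ, sq, mul_assoc]
  have hcx1 : c * x ≠ 1 := by
    intro h
    have h2 : x = c := by rw [← mul_one x, ← hcc, ← mul_assoc, hx c, h, one_mul]
    rw [h2, hcc, mul_one] at hxx
    exact hc1 hxx
  have hs : ∀ g h : G, (single g 1 : MonoidAlgebra ℚ G) * single h 1 = single (g * h) 1 :=
    fun g h => by rw [single_mul_single, one_mul]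
  have h0 := nilpotent_identity (R := MonoidAlgebra ℚ G) (a := single a 1) (b := single b 1)
    (c := single c 1) (x := single x 1) (by rw [hs, haa]) (by rw [hs, hbb])
    (by simp only [hs, hba]) (by simp only [hs, hac]) (by simp only [hs, hbc])
    (by rw [hs, hcc]; rfl) (by simp only [hs, hx]) (by simp only [hs, hx])
    (by simp only [hs, hx]) (by simp only [hs, hxx]; rfl)
  have h1 := hred.eq_zero _ ⟨2, (sq _).trans h0⟩
  have h2 := congrArg (fun y => coeff y a) h1
  have hcomm : ∀ p q : G, Commute p a → Commute q a → p * b * q ≠ a := by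
    intro p q hp hq h
    apply hne
    have hb : b = p⁻¹ * a * q⁻¹ := by rw [← h]; group
    have : Commute b a := by
      rw [hb]
      exact (hp.inv_left.mul_left (Commute.refl a)).mul_left hq.inv_left
    exact this.eq.symm
  have hXa : Commute x a := hx a
  have hCa : Commute c a := hac.symm
  have e1 : a * c ≠ a := by simpa using hc1
  have e2 : a * x ≠ a := by simpa using hx1
  have e3 : a * (c * x) ≠ a := by simpa using hcx1
  have f : ∀ q, Commute q a → x * b * q ≠ a := fun q hq => hcomm _ _ hXa hq
  have f' : ∀ q, Commute q a → x * x * (a * b) * q ≠ a := fun q hq => by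
    rw [← mul_assoc (x * x)]
    exact hcomm _ _ ((hXa.mul_left hXa).mul_left (Commute.refl a)) hq
  have f1 := f 1 (Commute.one_left a)
  have f2 := f c hCa
  have f3 := f x hXa
  have f4 := f _ (hCa.mul_left hXa)
  have g1 := f' 1 (Commute.one_left a)
  have g2 := f' c hCa
  have g3 := f' x hXa
  have g4 := f' _ (hCa.mul_left hXa)
  rw [mul_one] at f1 g1
  have hexp : (1 - single c 1) * (1 - single x 1 : MonoidAlgebra ℚ G)
      = single 1 1 - single x 1 - single c 1 + single (c * x) 1 := by
    rw [← hs, ← one_def]; noncomm_ring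
  rw [hexp] at h2
  simp only [mul_add, mul_sub, add_mul, hs, coeff_add, coeff_sub, coeff_single, Finsupp.add_apply,
    Finsupp.sub_apply, Finsupp.single_apply, mul_one, e1, e2, e3, f1, f2, f3, f4, g1, g2, g3, g4,
    if_true, if_false] at h2
  norm_num at h2

variable {A : Type*} [Ring A] [Module ℚ A] {Γ : Subring A}

theorem isHamiltonianTwoGroup_of_not_comm {G : Type u} [Group G] [Finite G]
    (hred : IsReduced (MonoidAlgebra ℚ G)) (hA : HasHyperbolicProperty A) (hΓ : IsZOrder Γ)
    (φ : MonoidAlgebra ℚ G →ₙ+* A) (hφ : Function.Injective φ)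
    (hnc : ¬ ∀ a b : G, a * b = b * a) : IsHamiltonianTwoGroup G := by
  have hn := normal_of_isReduced hred
  refine ⟨?_, hnc, hn⟩
  have hord := orderOf_mem_of_hyperbolic hA hΓ φ hφ
  rw [IsPGroup.iff_card]
  by_contra hcard
  obtain ⟨p, hp, hpd, hp2⟩ : ∃ p, p.Prime ∧ p ∣ Nat.card G ∧ p ≠ 2 := by
    by_contra! h
    exact hcard ⟨_, Nat.eq_prime_pow_of_unique_prime_dvd Nat.card_pos.ne' fun {d} hd hdd =>
      h d hd hdd⟩
  have := Fact.mk hp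
  obtain ⟨x, hx⟩ := exists_prime_orderOf_dvd_card' p hpd
  have hxc := commute_of_prime_orderOf hn (hx ▸ hp)
  push Not at hnc
  obtain ⟨a, b, hab⟩ := hnc
  obtain ⟨k, hk, hab⟩ := exists_pow_orderOf_eq_four_or_eight hn (hord a) hab
  obtain ⟨l, hl, hba⟩ := exists_pow_orderOf_eq_four_or_eight hn (hord b) hab.symm
  generalize a ^ k = a at *
  generalize b ^ l = b at *
  have hprod : ∀ u : G, (orderOf u = 4 ∨ orderOf u = 8) → p = 3 ∧ orderOf u = 4 := by
    intro u hu
    have hcop : (orderOf u).Coprime (orderOf x) := by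
      have h2 : Nat.Coprime 2 p := (Nat.coprime_primes Nat.prime_two hp).2 hp2.symm
      rw [hx]
      rcases hu with h | h <;> rw [h]
      · exact h2.pow_left 2
      · exact h2.pow_left 3
    have h1 := hord (u * x)
    rw [Commute.orderOf_mul_eq_mul_orderOf_of_coprime (hxc u).symm hcop, hx] at h1
    have := hp.two_le
    simp only [Finset.mem_insert, Finset.mem_singleton] at h1
    rcases hu with h | h <;> rw [h] at h1 ⊢ <;> omega
  obtain ⟨rfl, ha⟩ := hprod a hk
  obtain ⟨-, hb⟩ := hprod b hl
  have hsq : ∀ u v : G, orderOf u = 4 → ∀ z, u * v ≠ v * u →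
      z ∈ Subgroup.zpowers u → z ∈ Subgroup.zpowers v → z ≠ 1 → u * u = z := by
    intro u v hu z huv hzu hzv hz
    obtain ⟨m, hm⟩ := ((orderOf_pos_iff.1 (by omega)).mem_powers_iff_mem_zpowers).2 hzu
    have hm : u ^ m = z := hm
    have h2 : ¬ m.Coprime (orderOf u) := fun h => by
      obtain ⟨j, hj⟩ := exists_pow_eq_self_of_coprime h
      rw [hm] at hj
      exact huv (commute_of_mem_zpowers (hj ▸ pow_mem hzv j))
    have h4 : ¬ orderOf u ∣ m := fun h => hz (by rw [← hm, orderOf_dvd_iff_pow_eq_one.1 h])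
    rw [hu, show 4 = 2 ^ 2 from rfl, Nat.coprime_pow_right_iff two_pos, Nat.coprime_two_right,
      Nat.not_odd_iff_even] at h2
    rw [hu] at h4
    rw [← sq, ← hm, pow_eq_pow_iff_modEq, hu, Nat.ModEq]
    obtain ⟨r, rfl⟩ := h2
    omega
  have hc1 : a * b * a⁻¹ * b⁻¹ ≠ 1 := fun h => hba (by
    rw [mul_inv_eq_one, mul_inv_eq_iff_eq_mul] at h; exact h.symm)
  have haa := hsq a b ha _ hba.symm (commutator_mem_zpowers_left hn a b)
    (commutator_mem_zpowers_right hn a b) hc1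
  have hbb := hsq b a hb _ hba
    (commutator_mem_zpowers_right hn a b) (commutator_mem_zpowers_left hn a b) hc1
  refine not_isReduced_of_quaternion_mul_three haa hbb ?_ ?_ hba.symm hxc (hx ▸ pow_orderOf_eq_one x)
    ?_ hred
  · rw [← haa, ← sq, ← sq, ← pow_mul, ← orderOf_dvd_iff_pow_eq_one, ha]
  · group
  · rintro rfl
    simp at hx

theorem isHigmanGroup_or_isC5OrC8OrC12 {G : Type u} [Group G] [Finite G]
    (hred : IsReduced (MonoidAlgebra ℚ G)) (hA : HasHyperbolicProperty A) (hΓ : IsZOrder Γ)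
    (φ : MonoidAlgebra ℚ G →ₙ+* A) (hφ : Function.Injective φ) :
    IsHigmanGroup G ∨ IsC5OrC8OrC12 G := by
  by_cases hc : ∀ a b : G, a * b = b * a
  · let _ : CommGroup G := { ‹Group G› with mul_comm := hc }
    exact isHigmanGroup_or_of_comm hA hΓ φ hφ
  · exact .inl ⟨inferInstance, .inr (isHamiltonianTwoGroup_of_not_comm hred hA hΓ φ hφ hc)⟩

end NonabelianGroups

section CyclicGroups

open MonoidAlgebra NumberField NumberField.Units

theorem IsC5OrC8OrC12.exists_generator {G : Type*} [Group G] (h : IsC5OrC8OrC12 G) :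
    ∃ N, (N = 5 ∨ N = 8 ∨ N = 12) ∧ ∃ g : G, orderOf g = N ∧ ∀ x, x ∈ Subgroup.zpowers g := by
  have key : ∀ N, NeZero N → ∀ _ : G ≃* Multiplicative (ZMod N),
      ∃ g : G, orderOf g = N ∧ ∀ x, x ∈ Subgroup.zpowers g := by
    intro N _ e
    refine ⟨e.symm (Multiplicative.ofAdd 1), ?_, fun x => ⟨((e x).toAdd.val : ℤ), ?_⟩⟩
    · rw [MulEquiv.orderOf_eq, orderOf_ofAdd_eq_addOrderOf, ZMod.addOrderOf_one]
    · apply e.injective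
      simp only [zpow_natCast, map_pow, MulEquiv.apply_symm_apply]
      rw [← ofAdd_nsmul, nsmul_one, ZMod.natCast_zmod_val, ofAdd_toAdd]
  rcases h with ⟨⟨e⟩⟩ | ⟨⟨e⟩⟩ | ⟨⟨e⟩⟩
  · exact ⟨5, by simp, key _ inferInstance e⟩
  · exact ⟨8, by simp, key _ inferInstance e⟩
  · exact ⟨12, by simp, key _ inferInstance e⟩

theorem mul_comm_of_forall_mem_zpowers {G : Type*} [Group G] {g : G}
    (hg : ∀ x, x ∈ Subgroup.zpowers g) (a b : G) : a * b = b * a := by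
  obtain ⟨k, rfl⟩ := hg a
  obtain ⟨l, rfl⟩ := hg b
  exact zpow_mul_comm g k l

theorem rank_cyclotomicField_eq_one {N : ℕ} (hN : N = 5 ∨ N = 8 ∨ N = 12) :
    rank (CyclotomicField N ℚ) = 1 := by
  have : NeZero N := ⟨by omega⟩
  have : IsCyclotomicExtension {N} ℚ (CyclotomicField N ℚ) :=
    CyclotomicField.isCyclotomicExtension _ ℚ
  rw [rank_of_isCyclotomicExtension (CyclotomicField N ℚ) N (by omega)]
  rcases hN with rfl | rfl | rfl <;> decide

theorem exists_lift_surjective_of_generator {T : Type*} [CommGroup T] {t : T} {N : ℕ} [NeZero N]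
    (hto : orderOf t = N) (ht : ∀ x, x ∈ Subgroup.zpowers t) :
    ∃ χ : T →* CyclotomicField N ℚ, Function.Surjective (lift ℚ (CyclotomicField N ℚ) T χ) := by
  have : IsCyclotomicExtension {N} ℚ (CyclotomicField N ℚ) :=
    CyclotomicField.isCyclotomicExtension _ ℚ
  have hζ := IsCyclotomicExtension.zeta_spec N ℚ (CyclotomicField N ℚ)
  obtain ⟨ζ, h1⟩ := hζ.isUnit (NeZero.ne N)
  rw [← h1] at hζ
  let χ := (Units.coeHom (CyclotomicField N ℚ)).comp (monoidHomOfForallMemZpowers ht (g' := ζ)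
    (by rw [← (IsPrimitiveRoot.coe_units_iff.1 hζ).eq_orderOf, hto]))
  have hχ : χ t = ζ := by
    change ((monoidHomOfForallMemZpowers ht _ t : (CyclotomicField N ℚ)ˣ) : CyclotomicField N ℚ) = ζ
    rw [monoidHomOfForallMemZpowers_apply_gen]
  exact ⟨χ, lift_surjective_of_primitiveRoot (n := N) χ (t := t) (by rwa [hχ])⟩

variable {A : Type*} [Ring A] [Module ℚ A] {Γ : Subring A}

theorem HasHyperbolicProperty.not_injective_prod (hA : HasHyperbolicProperty A) (hΓ : IsZOrder Γ)
    {G H : Type u} [CommGroup G] [CommGroup H] [Finite G] [Finite H]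
    (hG : IsC5OrC8OrC12 G) (hH : IsC5OrC8OrC12 H)
    (φ : MonoidAlgebra ℚ G × MonoidAlgebra ℚ H →ₙ+* A) : ¬ Function.Injective φ := by
  intro hφ
  obtain ⟨N, hN, g, hgo, hg⟩ := hG.exists_generator
  obtain ⟨M, hM, h, hho, hh⟩ := hH.exists_generator
  have : NeZero N := ⟨by omega⟩
  have : NeZero M := ⟨by omega⟩
  obtain ⟨χ, hχ⟩ := exists_lift_surjective_of_generator hgo hg
  obtain ⟨ψ, hψ⟩ := exists_lift_surjective_of_generator hho hh
  have h0 := hA.rank_eq_zero_or hΓ φ hφ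
    ((lift ℚ _ G χ : _ →+* CyclotomicField N ℚ).comp (RingHom.fst _ _))
    (hχ.comp Prod.fst_surjective)
    ((lift ℚ _ H ψ : _ →+* CyclotomicField M ℚ).comp (RingHom.snd _ _))
    (hψ.comp Prod.snd_surjective) (fun hker => by
      have h1 : ((0, 1) : MonoidAlgebra ℚ G × MonoidAlgebra ℚ H) ∈ RingHom.ker
        ((lift ℚ _ G χ : _ →+* CyclotomicField N ℚ).comp
          (RingHom.fst (MonoidAlgebra ℚ G) (MonoidAlgebra ℚ H))) := by
        simp [RingHom.mem_ker]
      rw [hker] at h1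
      simp [RingHom.mem_ker] at h1)
  rw [rank_cyclotomicField_eq_one hN, rank_cyclotomicField_eq_one hM] at h0
  omega

/-- The inclusion of a component in a product of rings. -/
def piSingleHom {ι : Type*} [DecidableEq ι] (R : ι → Type*) [∀ i, Ring (R i)] (i : ι) :
    R i →ₙ+* ∀ k, R k where
  toFun := Pi.single i
  map_zero' := Pi.single_zero i
  map_add' := Pi.single_add i
  map_mul' := Pi.single_mul i

/-- The inclusion of two components in a product of rings. -/
def piPairHom {ι : Type*} [DecidableEq ι] (R : ι → Type*) [∀ i, Ring (R i)] {i j : ι}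
    (hij : i ≠ j) : R i × R j →ₙ+* ∀ k, R k where
  toFun z := Pi.single i z.1 + Pi.single j z.2
  map_zero' := by simp
  map_add' x y := by simp only [Prod.fst_add, Prod.snd_add, Pi.single_add]; abel
  map_mul' x y := by
    have h : ∀ (a : R i) (b : R j), (Pi.single i a * Pi.single j b : ∀ k, R k) = 0 := fun a b => by
      rw [← Pi.single_mul_left, Pi.single_eq_of_ne hij, mul_zero, Pi.single_zero]
    have h' : ∀ (a : R i) (b : R j), (Pi.single j b * Pi.single i a : ∀ k, R k) = 0 := fun a b => by
      rw [← Pi.single_mul_left, Pi.single_eq_of_ne hij.symm, mul_zero, Pi.single_zero]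
    simp only [Prod.fst_mul, Prod.snd_mul, Pi.single_mul, mul_add, add_mul, h, h']
    abel

theorem piPairHom_injective {ι : Type*} [DecidableEq ι] (R : ι → Type*) [∀ i, Ring (R i)] {i j : ι}
    (hij : i ≠ j) : Function.Injective (piPairHom R hij) := by
  intro x y h
  change (Pi.single i x.1 + Pi.single j x.2 : ∀ k, R k) = Pi.single i y.1 + Pi.single j y.2 at h
  have hi := congrFun h i
  have hj := congrFun h j
  simp only [Pi.add_apply, Pi.single_eq_same, Pi.single_eq_of_ne hij, Pi.single_eq_of_ne hij.symm,
    add_zero, zero_add] at hi hj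
  exact Prod.ext hi hj

end CyclicGroups

section Products

open MonoidAlgebra NumberField NumberField.Units

variable {n : ℕ} {G : Fin n → Type u} [∀ i, Group (G i)] [∀ i, Finite (G i)]

theorem exists_isZOrder_pi (G : Fin n → Type u) [∀ i, Group (G i)] [∀ i, Finite (G i)] :
    ∃ Γ : Subring (∀ i, MonoidAlgebra ℚ (G i)), IsZOrder Γ := by
  let ψ : (∀ i, MonoidAlgebra ℤ (G i)) →+* (∀ i, MonoidAlgebra ℚ (G i)) :=
    RingHom.pi fun i => (mapRingHom (G i) (Int.castRingHom ℚ)).comp (Pi.evalRingHom _ i)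
  refine ⟨ψ.range, ?_, ?_⟩
  · have h : ψ.range.toAddSubgroup = (⊤ : AddSubgroup _).map ψ.toAddMonoidHom := by
      ext; simp
    rw [h]
    have : ∀ i, Module.Finite ℤ (MonoidAlgebra ℤ (G i)) := fun i =>
      Module.Finite.of_surjective (coeffLinearEquiv ℤ).symm.toLinearMap
        (coeffLinearEquiv ℤ).symm.surjective
    have hfg : (⊤ : AddSubgroup (∀ i, MonoidAlgebra ℤ (G i))).FG :=
      (Module.Finite.iff_addGroup_fg.1 inferInstance : AddGroup.FG _).out
    obtain ⟨s, hs⟩ := hfg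
    classical
    refine ⟨s.image ψ, ?_⟩
    rw [← hs, AddMonoidHom.map_closure, Finset.coe_image]
    rfl
  · rw [eq_top_iff]
    have h : ∀ i (y : MonoidAlgebra ℚ (G i)),
        (Pi.single i y : ∀ i, MonoidAlgebra ℚ (G i)) ∈
          Submodule.span ℚ (ψ.range : Set (∀ i, MonoidAlgebra ℚ (G i))) := by
      intro i y
      induction y using MonoidAlgebra.induction_linear with
      | zero => simp
      | add x y hx hy => rw [Pi.single_add]; exact add_mem hx hy
      | single g r =>
        have hr : (Pi.single i (single g r) : ∀ i, MonoidAlgebra ℚ (G i))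
            = r • Pi.single i (single g 1) := by
          rw [← Pi.single_smul, smul_single, smul_eq_mul, mul_one]
        rw [hr]
        refine Submodule.smul_mem _ _ (Submodule.subset_span ⟨Pi.single i (single g 1), ?_⟩)
        funext k
        rcases eq_or_ne k i with rfl | hk
        · change mapRingHom _ (Int.castRingHom ℚ)
            ((Pi.single k (single g 1) : ∀ i, MonoidAlgebra ℤ (G i)) k) = _
          simp
        · change mapRingHom _ (Int.castRingHom ℚ)
            ((Pi.single i (single g 1) : ∀ i, MonoidAlgebra ℤ (G i)) k) = _
          simp [Pi.single_eq_of_ne hk]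
    intro x _
    rw [← Finset.univ_sum_single x]
    exact sum_mem fun i _ => h i _

theorem group_conditions_of_hyperbolic (hred : IsReduced (∀ i, MonoidAlgebra ℚ (G i)))
    (hA : HasHyperbolicProperty (∀ i, MonoidAlgebra ℚ (G i))) :
    (∀ i, IsHigmanGroup (G i) ∨ IsC5OrC8OrC12 (G i)) ∧
      ∀ i j, IsC5OrC8OrC12 (G i) → IsC5OrC8OrC12 (G j) → i = j := by
  obtain ⟨Γ, hΓ⟩ := exists_isZOrder_pi G
  refine ⟨fun i => ?_, fun i j hi hj => ?_⟩
  · let φ : MonoidAlgebra ℚ (G i) →ₙ+* ∀ i, MonoidAlgebra ℚ (G i) :=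
      piSingleHom (fun i => MonoidAlgebra ℚ (G i)) i
    have hφ : Function.Injective φ := Pi.single_injective (M := fun i => MonoidAlgebra ℚ (G i)) i
    have hGi : IsReduced (MonoidAlgebra ℚ (G i)) := by
      refine isReduced_of_mul_self fun x hx => ?_
      have h : (Pi.single i x : ∀ i, MonoidAlgebra ℚ (G i)) * Pi.single i x = 0 := by
        rw [← Pi.single_mul, hx, Pi.single_zero]
      have h1 := congrFun (hred.eq_zero _ ⟨2, (sq _).trans h⟩) i
      rwa [Pi.single_eq_same] at h1
    exact isHigmanGroup_or_isC5OrC8OrC12 hGi hA hΓ φ hφ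
  · by_contra hij
    obtain ⟨N, -, g, -, hg⟩ := hi.exists_generator
    obtain ⟨M, -, h, -, hh⟩ := hj.exists_generator
    let _ : CommGroup (G i) :=
      { (inferInstance : Group (G i)) with mul_comm := mul_comm_of_forall_mem_zpowers hg }
    let _ : CommGroup (G j) :=
      { (inferInstance : Group (G j)) with mul_comm := mul_comm_of_forall_mem_zpowers hh }
    exact hA.not_injective_prod hΓ hi hj (piPairHom (fun i => MonoidAlgebra ℚ (G i)) hij)
      (piPairHom_injective _ hij)

theorem IsHigmanGroup.isReduced_and_hasTorsionIntegralUnits {G : Type u} [Group G]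
    (h : IsHigmanGroup G) :
    IsReduced (MonoidAlgebra ℚ G) ∧ HasTorsionIntegralUnits (MonoidAlgebra ℚ G) := by
  obtain ⟨_, ⟨hc, hexp⟩ | h⟩ := h
  · let _ : CommGroup G := { ‹Group G› with mul_comm := hc }
    exact isReduced_and_hasTorsionIntegralUnits_of_exponent hexp
  · exact isReduced_and_hasTorsionIntegralUnits_of_hamiltonian h

theorem IsC5OrC8OrC12.isReduced_and_exists_algHom {G : Type u} [Group G] [Finite G]
    (h : IsC5OrC8OrC12 G) : IsReduced (MonoidAlgebra ℚ G) ∧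
      ∃ (K : Type) (_ : Field K) (_ : NumberField K) (Φ : MonoidAlgebra ℚ G →ₐ[ℚ] K), rank K ≤ 1 ∧
        ∀ u v, u * v = 1 → v * u = 1 → IsIntegral ℤ u → IsIntegral ℤ v → Φ u = 1 → u ^ 12 = 1 := by
  obtain ⟨N, hN, g, hgo, hg⟩ := h.exists_generator
  have : NeZero N := ⟨by omega⟩
  let _ : CommGroup G := { ‹Group G› with mul_comm := mul_comm_of_forall_mem_zpowers hg }
  have : IsCyclotomicExtension {N} ℚ (CyclotomicField N ℚ) :=
    CyclotomicField.isCyclotomicExtension _ ℚ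
  obtain ⟨h1, Φ, h2⟩ := isReduced_and_exists_algHom_of_cyclic hN hg hgo (CyclotomicField N ℚ)
  exact ⟨h1, CyclotomicField N ℚ, inferInstance, inferInstance, Φ,
    (rank_cyclotomicField_eq_one hN).le, h2⟩

theorem isReduced_pi_of_group_conditions
    (hG : ∀ i, IsHigmanGroup (G i) ∨ IsC5OrC8OrC12 (G i)) :
    IsReduced (∀ i, MonoidAlgebra ℚ (G i)) := by
  have : ∀ i, IsReduced (MonoidAlgebra ℚ (G i)) := fun i =>
    (hG i).elim (fun h => h.isReduced_and_hasTorsionIntegralUnits.1)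
      fun h => h.isReduced_and_exists_algHom.1
  infer_instance

theorem hasHyperbolicProperty_pi_of_group_conditions
    (hG : ∀ i, IsHigmanGroup (G i) ∨ IsC5OrC8OrC12 (G i))
    (huniq : ∀ i j, IsC5OrC8OrC12 (G i) → IsC5OrC8OrC12 (G j) → i = j) :
    HasHyperbolicProperty (∀ i, MonoidAlgebra ℚ (G i)) := by
  rintro Γ hΓ ⟨f, hf⟩
  have : Module.Finite ℤ Γ := Module.Finite.iff_addGroup_fg.2
    ((AddGroup.fg_iff_addSubgroup_fg Γ.toAddSubgroup).2 hΓ.fg)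
  have hint : ∀ i (x : Γ), IsIntegral ℤ ((x : ∀ i, MonoidAlgebra ℚ (G i)) i) := fun i x =>
    (Algebra.IsIntegral.isIntegral (R := ℤ) x).map
      ((Pi.evalRingHom (fun i => MonoidAlgebra ℚ (G i)) i).comp Γ.subtype).toIntAlgHom
  have hmul : ∀ i (w : (↥Γ)ˣ), ((w : Γ) : ∀ i, MonoidAlgebra ℚ (G i)) i *
      ((w⁻¹ : (↥Γ)ˣ) : Γ).1 i = 1 := fun i w => by
    have h := congrArg (fun z : Γ => (z : ∀ i, MonoidAlgebra ℚ (G i)) i) w.mul_inv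
    exact h
  have hmul' : ∀ i (w : (↥Γ)ˣ), ((w⁻¹ : (↥Γ)ˣ) : Γ).1 i *
      ((w : Γ) : ∀ i, MonoidAlgebra ℚ (G i)) i = 1 := fun i w => by
    have h := congrArg (fun z : Γ => (z : ∀ i, MonoidAlgebra ℚ (G i)) i) w.inv_mul
    exact h
  have hhigman : ∀ i (w : (↥Γ)ˣ), IsHigmanGroup (G i) → ((w : Γ).1 i) ^ 12 = 1 := fun i w h =>
    h.isReduced_and_hasTorsionIntegralUnits.2 _ _ (hmul i w) (hmul' i w) (hint i _) (hint i _)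
  obtain ⟨v, hv1, hv⟩ : ∃ v, v ≠ 1 ∧ ∀ i, ((f v : Γ).1 i) ^ 12 = 1 := by
    by_cases hex : ∃ i, IsC5OrC8OrC12 (G i)
    · obtain ⟨i, hi⟩ := hex
      obtain ⟨-, K, _, _, Φ, hK, hΦ⟩ := hi.isReduced_and_exists_algHom
      let Φ' : MonoidAlgebra ℚ (G i) →+* K := Φ
      let θ : Γ →+* 𝓞 K := (Φ'.comp ((Pi.evalRingHom (fun i => MonoidAlgebra ℚ (G i)) i).comp
        Γ.subtype)).codRestrict (integralClosure ℤ K) fun x => (hint i x).map Φ'.toIntAlgHom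
      have h := not_injective_units_of_rank_le_one K hK ((Units.map (θ : Γ →* 𝓞 K)).comp f)
      rw [injective_iff_map_eq_one] at h
      push Not at h
      obtain ⟨v, hv, hv1⟩ := h
      refine ⟨v, hv1, fun j => ?_⟩
      rcases hG j with hj | hj
      · exact hhigman j _ hj
      · obtain rfl := huniq j i hj hi
        refine hΦ _ _ (hmul j _) (hmul' j _) (hint j _) (hint j _) ?_
        exact congrArg (fun z : (𝓞 K)ˣ => ((z : 𝓞 K) : K)) hv
    · push Not at hex
      exact ⟨Multiplicative.ofAdd (1, 0), by simp [← ofAdd_zero],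
        fun i => hhigman i _ ((hG i).resolve_right (hex i))⟩
  have h1 : f (v ^ 12) = 1 := by
    rw [map_pow]
    ext i : 3
    exact hv i
  have h2 : v ^ 12 = 1 := hf (by rw [h1, map_one])
  apply hv1
  have h3 : (12 : ℕ) • v.toAdd = 0 := h2
  exact (smul_eq_zero.1 h3).resolve_left (by norm_num)

end Products

theorem theorem4p3 (S : Type u) [Semigroup S] [Finite S] [Nonempty S] :
    ((NilpotentFree (MonoidAlgebra ℚ S) ∧ IsUnitalWithHyperbolicProperty (MonoidAlgebra ℚ S)) ↔
      ∃ (n : ℕ) (C : Fin (n + 1) → Set S) (G : Fin n → Type u) (_ : ∀ i, Group (G i)),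
        IsHigmanSeries C G) ∧
    (∀ (n : ℕ) (C : Fin (n + 1) → Set S) (G : Fin n → Type u) [∀ i, Group (G i)],
      IsHigmanSeries C G → IsInverseSemigroup S ∧ IsDisjointUnionOfGroups S G) := by
  refine ⟨⟨fun ⟨hnil, hhyp⟩ => ?_, fun ⟨n, C, G, _, h⟩ => ?_⟩, fun n C G _ h => ?_⟩
  · obtain ⟨n, G, _, ι, hι⟩ := exists_stratification_of_nilpotentFree hnil
    have : ∀ i, Finite (G i) := fun i => Finite.of_injective _ (hι.injective i)
    have hcond := group_conditions_of_hyperbolic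
      ((nilpotentFree_iff_of_ringEquiv hι.ringEquivPi).1 hnil)
      ((isUnitalWithHyperbolicProperty_iff_of_ringEquiv hι.ringEquivPi).1 hhyp)
    obtain ⟨C, hC, hfac⟩ := hι.exists_series
    exact ⟨n, C, G, inferInstance, hC, hfac, hcond.1, hcond.2⟩
  · obtain ⟨ι, hι⟩ := exists_stratification_of_series h.isPrincipalSeries h.factor_iso
    have : ∀ i, Finite (G i) := fun i => Finite.of_injective _ (hι.injective i)
    exact ⟨(nilpotentFree_iff_of_ringEquiv hι.ringEquivPi).2
        (isReduced_pi_of_group_conditions h.group_type),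
      (isUnitalWithHyperbolicProperty_iff_of_ringEquiv hι.ringEquivPi).2
        (hasHyperbolicProperty_pi_of_group_conditions h.group_type h.exceptional_unique)⟩
  · obtain ⟨ι, hι⟩ := exists_stratification_of_series h.isPrincipalSeries h.factor_iso
    exact ⟨hι.isInverseSemigroup, hι.isDisjointUnionOfGroups⟩
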